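/- Let $(B_t)_{0\le t\le 1}$ be a standard $d$-dimensional Brownian motion started at $0$, and let $\mu$ be its occupation measure, $\mu(\Lambda)=\int_0^1 \mathbf 1_\Lambda(B_t)\,dt$ for Borel sets $\Lambda\subset\mathbb R^d$. A kernel is a (weakly) decreasing function $f:[0,\infty)\to[0,\infty]$ such that $\lim_{r\downarrow 0}f(r)=f(0)$ if this limit is finite, and the energy of a Borel measure $\nu$ on $\mathbb R^d$ with respect to $f$ is $$\mathcal E_f(\nu)=\int_{\mathbb R^d}\int_{\mathbb R^d} f(|x-y|)\,d\nu(x)\,d\nu(y)\in[0,\infty],$$ where $|\cdot|$ is the Euclidean norm. With probability one, there exists a finite constant $C=C(\omega)$, depending on the path but not on the kernel, such that for all kernels $f$ $$\mathcal E_f(\mu)\le C\int_0^1 r\,f(r)\,dr\quad\text{if } d\ge 3,\qquad \mathcal E_f(\mu)\le C\int_0^1 r\log\tfrac1r\, f(r)\,dr\quad\text{if } d=2 .$$ -/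

import Mathlib

open MeasureTheory ProbabilityTheory Set Filter Topology
open scoped NNReal ENNReal

/-- A `d`-dimensional standard Brownian motion `(B t : 0 ≤ t ≤ 1)` started at `0`:
independent increments, `B t - B s` centered Gaussian with covariance matrix `(t - s) • 1`,
and continuous sample paths (almost surely). -/
structure IsBrownianMotion {Ω : Type*} [MeasurableSpace Ω] {d : ℕ}
    (B : unitInterval → Ω → EuclideanSpace ℝ (Fin d)) (P : Measure Ω) : Prop where
  start_zero : ∀ᵐ ω ∂P, B 0 ω = 0
  indep_increments : HasIndepIncrements B P
  law_increments : ∀ s t : unitInterval, s ≤ t →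
    HasLaw (fun ω ↦ B t ω - B s ω)
      (multivariateGaussian 0 (((t : ℝ) - (s : ℝ)) • (1 : Matrix (Fin d) (Fin d) ℝ))) P
  continuous_paths : ∀ᵐ ω ∂P, Continuous fun t ↦ B t ω

/-- The occupation measure of a path `w` on `[0,1]`, the image of Lebesgue measure under `w`;
`occupationMeasure_apply` gives the formula `μ(Λ) = ∫₀¹ 1_Λ(w t) dt`. -/
noncomputable def occupationMeasure {d : ℕ} (w : unitInterval → EuclideanSpace ℝ (Fin d)) :
    Measure (EuclideanSpace ℝ (Fin d)) :=
  (volume : Measure unitInterval).map w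

theorem occupationMeasure_apply {d : ℕ} {w : unitInterval → EuclideanSpace ℝ (Fin d)}
    (hw : Continuous w) {Λ : Set (EuclideanSpace ℝ (Fin d))} (hΛ : MeasurableSet Λ) :
    occupationMeasure w Λ = ∫⁻ t : unitInterval, Λ.indicator 1 (w t) := by
  rw [occupationMeasure, ← lintegral_indicator_one hΛ,
    lintegral_map (measurable_one.indicator hΛ) hw.measurable]

/-- A kernel function `f : [0,∞) → [0,∞]`: weakly decreasing, with `f(r) → f(0)` as `r ↓ 0`.
(When the limit is infinite, `f(0) = ∞` holds by monotonicity, so this only restricts `f`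
when the limit is finite.) -/
structure IsKernelFunction (f : ℝ≥0 → ℝ≥0∞) : Prop where
  antitone : Antitone f
  tendsto_zero : Tendsto f (𝓝[>] 0) (𝓝 (f 0))

/-- The energy of a Borel measure `ν` with respect to `f`. -/
noncomputable def energy {d : ℕ} (f : ℝ≥0 → ℝ≥0∞) (ν : Measure (EuclideanSpace ℝ (Fin d))) :
    ℝ≥0∞ :=
  ∫⁻ y, ∫⁻ x, f (nndist x y) ∂ν ∂ν

/-! Everything reduces to one random sequence that does not involve the kernel: the Lebesgue measure
`selfCloseTime` of the set of pairs of times at which the path is within 2⁻ⁿ of itself. Cutting a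
decreasing f along dyadic shells bounds the energy by f(1) + ∑ f(2⁻⁽ⁿ⁺¹⁾) · `selfCloseTime`(2⁻ⁿ). If
this measure is at most a constant times the mass that the weight r, or r log(1/r), gives to the
shell of index n + 1, the sum is dominated by the weighted integral of f
(`energy_le_of_selfCloseTime_le`). The random constant is chosen before f, which gives uniformity
over kernels.

It remains to show that almost surely, for all large n and with r = 2⁻ⁿ, the measure is O(Qₙ), where
Qₙ is of order r² if d ≥ 3 and n r² if d = 2. This is the order of its mean bound, since an
increment over time u lies in a ball of radius r with probability at most min(1, (r u^(-1/2))^m)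
whenever m ≤ d. Borel–Cantelli needs summable tails. Pairs s ≤ t are split according to whether t -
s exceeds g = (n+1)⁻².

Short pairs: disjoint time intervals are independent, so only overlapping intervals contribute to
the variance. Overlap confines the second interval near a first one that ranges over a set of
measure at most g; the variance is at most 2 g Q² and Chebyshev gives a tail 2g
(`measure_shortPairs_le`).

Long pairs: their typical contribution is of smaller order than Qₙ. For d ≥ 3 the first moment r³
g^(-3/2) is enough, because a power of r is gained. For d = 2 the first moment gains too little, and
a second moment of order r⁴ g^(-1/4) is compared with Qₙ² of order n² r⁴, leaving n^(-3/2)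
(`measure_longPairs_two_le`). -/

/-! ### Gaussian small-ball estimates. -/

/-- A bound for the probability that a centred Gaussian vector of covariance `u • 1` in dimension
at least `m` lies in a given ball of radius `r`. -/
noncomputable def hitBound (m : ℕ) (r u : ℝ) : ℝ≥0∞ :=
  min 1 ((ENNReal.ofReal r * ENNReal.ofReal u ^ (-(1 / 2) : ℝ)) ^ m)

theorem hitBound_le_one (m : ℕ) (r u : ℝ) : hitBound m r u ≤ 1 := min_le_left _ _

theorem hitBound_antitone (m : ℕ) (r : ℝ) : Antitone (hitBound m r) := by
  intro u v huv
  unfold hitBound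
  gcongr min 1 ((_ * ?_) ^ m)
  rw [ENNReal.rpow_neg, ENNReal.rpow_neg]
  gcongr

theorem measurable_hitBound (m : ℕ) (r : ℝ) : Measurable (hitBound m r) :=
  (hitBound_antitone m r).measurable

/-- The density is at most (2πu)^(-1/2), the interval has length 2r, and 2 ≤ √(2π) makes the
constant 1. -/
theorem gaussianReal_closedBall_le {u : ℝ≥0} (hu : u ≠ 0) (a y r : ℝ) :
    gaussianReal a u (Metric.closedBall y r) ≤
      ENNReal.ofReal r * ENNReal.ofReal u ^ (-(1 / 2) : ℝ) := by
  have hu' : (0 : ℝ) < u := by positivity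
  have hpdf : ∀ x, gaussianPDF a u x ≤ ENNReal.ofReal (√(2 * Real.pi * u))⁻¹ := by
    intro x
    unfold gaussianPDF gaussianPDFReal
    refine ENNReal.ofReal_le_ofReal (mul_le_of_le_one_right (by positivity) ?_)
    rw [Real.exp_le_one_iff]
    exact div_nonpos_of_nonpos_of_nonneg (neg_nonpos.2 (sq_nonneg _)) (by positivity)
  rw [gaussianReal_apply _ hu]
  calc ∫⁻ x in Metric.closedBall y r, gaussianPDF a u x
      ≤ ∫⁻ x in Metric.closedBall y r, ENNReal.ofReal (√(2 * Real.pi * u))⁻¹ :=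
        lintegral_mono fun x ↦ hpdf x
    _ = ENNReal.ofReal (√(2 * Real.pi * u))⁻¹ * ENNReal.ofReal (2 * r) := by
        rw [setLIntegral_const, Real.volume_closedBall]
    _ ≤ ENNReal.ofReal r * ENNReal.ofReal u ^ (-(1 / 2) : ℝ) := by
        rcases le_or_gt r 0 with hr | hr
        · simp [ENNReal.ofReal_of_nonpos (by linarith : 2 * r ≤ 0)]
        rw [ENNReal.ofReal_rpow_of_pos hu', ← ENNReal.ofReal_mul (by positivity),
          ← ENNReal.ofReal_mul hr.le]
        refine ENNReal.ofReal_le_ofReal ?_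
        rw [Real.rpow_neg hu'.le, ← Real.sqrt_eq_rpow, ← div_eq_inv_mul, ← div_eq_mul_inv,
          div_le_div_iff₀ (by positivity) (by positivity)]
        have h2 : 2 * √(u : ℝ) ≤ √(2 * Real.pi * u) := by
          refine Real.le_sqrt_of_sq_le ?_
          rw [mul_pow, Real.sq_sqrt hu'.le]
          nlinarith [Real.pi_gt_three]
        nlinarith

theorem map_pi_gaussianReal_eq_multivariateGaussian {ι : Type*} [Fintype ι] [DecidableEq ι]
    (u : ℝ≥0) :
    (Measure.pi fun _ : ι ↦ gaussianReal 0 u).map (WithLp.toLp 2) =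
      multivariateGaussian 0 ((u : ℝ) • (1 : Matrix ι ι ℝ)) := by
  apply Measure.ext_of_charFun (E := EuclideanSpace ℝ ι)
  ext t
  have hS : ((u : ℝ) • (1 : Matrix ι ι ℝ)).PosSemidef := Matrix.PosSemidef.one.smul u.2
  rw [charFun_multivariateGaussian hS]
  simp_rw [charFun_pi, charFun_gaussianReal, ← Complex.exp_sum]
  congr 1
  simp [Finset.sum_div, dotProduct, Matrix.smul_mulVec]
  refine Finset.sum_congr rfl fun i _ ↦ ?_
  ring

/-- A Euclidean ball lies in the cube with the same centre and radius, so the one-dimensional bounds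
multiply. Capping each factor by 1 allows all but m of them to be dropped. -/
theorem multivariateGaussian_closedBall_le {d m : ℕ} (hm : m ≤ d) {u : ℝ} (hu : 0 ≤ u)
    (y : EuclideanSpace ℝ (Fin d)) {r : ℝ} (hr : 0 < r) :
    multivariateGaussian 0 (u • (1 : Matrix (Fin d) (Fin d) ℝ)) (Metric.closedBall y r) ≤
      hitBound m r u := by
  rcases m.eq_zero_or_pos with rfl | hmpos
  · simpa [hitBound] using prob_le_one
  rcases hu.eq_or_lt with rfl | hu
  -- In `ℝ≥0∞` the power 0 ^ (-1/2) is ∞, so at u = 0 the minimum is the trivial bound 1.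
  · have : hitBound m r 0 = 1 := by
      have h : ENNReal.ofReal r ≠ 0 := by simpa using hr
      simp [hitBound, ENNReal.mul_top h, hmpos.ne']
    rw [this]
    exact prob_le_one
  lift u to ℝ≥0 using hu.le
  have hu0 : u ≠ 0 := by rintro rfl; simp at hu
  set b := ENNReal.ofReal r * ENNReal.ofReal u ^ (-(1 / 2) : ℝ) with hb
  refine le_min prob_le_one ?_
  rw [← map_pi_gaussianReal_eq_multivariateGaussian,
    Measure.map_apply (by fun_prop) Metric.isClosed_closedBall.measurableSet]
  calc (Measure.pi fun _ : Fin d ↦ gaussianReal 0 u) (WithLp.toLp 2 ⁻¹' Metric.closedBall y r)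
      ≤ (Measure.pi fun _ : Fin d ↦ gaussianReal 0 u)
          (Set.pi univ fun i ↦ Metric.closedBall (y i) r) := by
        refine measure_mono fun x hx i _ ↦ ?_
        rw [mem_preimage, Metric.mem_closedBall, dist_eq_norm] at hx
        rw [Metric.mem_closedBall, dist_eq_norm]
        exact (PiLp.norm_apply_le (WithLp.toLp 2 x - y) i).trans hx
    _ = ∏ i : Fin d, gaussianReal 0 u (Metric.closedBall (y i) r) := Measure.pi_pi _ _
    _ ≤ ∏ i : Fin d, min 1 b :=
        Finset.prod_le_prod' fun i _ ↦ le_min prob_le_one (gaussianReal_closedBall_le hu0 _ _ _)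
    _ = (min 1 b) ^ d := by simp
    _ ≤ (min 1 b) ^ m := pow_le_pow_right_of_le_one' (min_le_left _ _) hm
    _ ≤ b ^ m := by gcongr; exact min_le_right _ _

/-! ### Independence of increments and joint probabilities of close encounters. -/

section

variable {Ω : Type*} [MeasurableSpace Ω] {P : Measure Ω}

/-- Condition on (Y, Z): the first event then says that X lies in the ball about -Y, which has
probability at most c whatever Y is. -/
theorem ProbabilityTheory.IndepFun.measure_norm_add_le_inter_le [IsProbabilityMeasure P] {E : Type*} [NormedAddCommGroup E]
    [MeasurableSpace E] [BorelSpace E] [SecondCountableTopology E] {X Y Z : Ω → E}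
    (hX : AEMeasurable X P) (hY : AEMeasurable Y P) (hZ : AEMeasurable Z P)
    (h : IndepFun X (fun ω ↦ (Y ω, Z ω)) P) {r : ℝ} {c : ℝ≥0∞}
    (hc : ∀ y, P.map X (Metric.closedBall y r) ≤ c) :
    P ({ω | ‖X ω + Y ω‖ ≤ r} ∩ {ω | ‖Z ω‖ ≤ r}) ≤ c * P {ω | ‖Z ω‖ ≤ r} := by
  have hYZ : AEMeasurable (fun ω ↦ (Y ω, Z ω)) P := hY.prodMk hZ
  have hprod := (indepFun_iff_map_prod_eq_prod_map_map hX hYZ).1 h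
  have hS : MeasurableSet {p : E × E × E | ‖p.1 + p.2.1‖ ≤ r ∧ ‖p.2.2‖ ≤ r} :=
    MeasurableSet.inter (s₁ := {p : E × E × E | ‖p.1 + p.2.1‖ ≤ r})
      (s₂ := {p : E × E × E | ‖p.2.2‖ ≤ r}) (measurableSet_le (by fun_prop) (by fun_prop))
      (measurableSet_le (by fun_prop) (by fun_prop))
  have hT : MeasurableSet {p : E × E | ‖p.2‖ ≤ r} := measurableSet_le (by fun_prop) (by fun_prop)
  have e1 : P ({ω | ‖X ω + Y ω‖ ≤ r} ∩ {ω | ‖Z ω‖ ≤ r}) =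
      P.map (fun ω ↦ (X ω, (Y ω, Z ω))) {p | ‖p.1 + p.2.1‖ ≤ r ∧ ‖p.2.2‖ ≤ r} := by
    rw [Measure.map_apply_of_aemeasurable (hX.prodMk hYZ) hS]
    rfl
  have e2 : P {ω | ‖Z ω‖ ≤ r} = P.map (fun ω ↦ (Y ω, Z ω)) {p | ‖p.2‖ ≤ r} := by
    rw [Measure.map_apply_of_aemeasurable hYZ hT]
    rfl
  have := Measure.isProbabilityMeasure_map hX
  have := Measure.isProbabilityMeasure_map hYZ
  rw [e1, e2, hprod, Measure.prod_apply_symm hS, ← lintegral_indicator_one hT,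
    ← lintegral_const_mul _ (measurable_one.indicator hT)]
  refine lintegral_mono fun p ↦ ?_
  by_cases hp : ‖p.2‖ ≤ r
  · rw [indicator_of_mem (by exact hp), Pi.one_apply, mul_one]
    refine le_trans (measure_mono fun x hx ↦ ?_) (hc (-p.1))
    simpa [dist_eq_norm] using hx.1
  · have : (fun x ↦ (x, p)) ⁻¹' {p : E × E × E | ‖p.1 + p.2.1‖ ≤ r ∧ ‖p.2.2‖ ≤ r} = ∅ := by
      ext x; simp [hp]
    simp [this]

/-- The event that the process is at distance at most `r` at the times `s` and `t`. -/
def closeEvent {Ω : Type*} {d : ℕ} (B : unitInterval → Ω → EuclideanSpace ℝ (Fin d)) (r : ℝ)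
    (s t : unitInterval) : Set Ω :=
  {ω | ‖B t ω - B s ω‖ ≤ r}

namespace IsBrownianMotion

variable {d : ℕ} {B : unitInterval → Ω → EuclideanSpace ℝ (Fin d)}

theorem aemeasurable_sub (hB : IsBrownianMotion B P) (s t : unitInterval) :
    AEMeasurable (fun ω ↦ B t ω - B s ω) P := by
  rcases le_total s t with h | h
  · exact (hB.law_increments s t h).aemeasurable
  · simpa [Pi.neg_def] using (hB.law_increments t s h).aemeasurable.neg

theorem aemeasurable (hB : IsBrownianMotion B P) (t : unitInterval) : AEMeasurable (B t) P := by
  refine (hB.aemeasurable_sub 0 t).congr ?_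
  filter_upwards [hB.start_zero] with ω hω
  simp [hω]

theorem map_sub_closedBall_le (hB : IsBrownianMotion B P) {m : ℕ} (hm : m ≤ d)
    {s t : unitInterval} (hst : s ≤ t) {r : ℝ} (hr : 0 < r) (y : EuclideanSpace ℝ (Fin d)) :
    P.map (fun ω ↦ B t ω - B s ω) (Metric.closedBall y r) ≤ hitBound m r (t - s) := by
  rw [(hB.law_increments s t hst).map_eq]
  exact multivariateGaussian_closedBall_le hm (sub_nonneg.2 hst) y hr

theorem measure_closeEvent_le (hB : IsBrownianMotion B P) {m : ℕ} (hm : m ≤ d)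
    {s t : unitInterval} (hst : s ≤ t) {r : ℝ} (hr : 0 < r) :
    P (closeEvent B r s t) ≤ hitBound m r (t - s) := by
  refine le_trans (le_of_eq ?_) (hB.map_sub_closedBall_le hm hst hr 0)
  rw [Measure.map_apply_of_aemeasurable (hB.aemeasurable_sub s t)
    Metric.isClosed_closedBall.measurableSet]
  congr 1
  ext ω
  simp [closeEvent]

theorem indepFun_sub_future (hB : IsBrownianMotion B P) {a b v w : unitInterval} (hab : a ≤ b)
    (hv : b ≤ v) (hw : b ≤ w) :
    IndepFun (fun ω ↦ B b ω - B a ω) (fun ω ↦ (B v ω - B b ω, B w ω - B b ω)) P := by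
  wlog hvw : v ≤ w generalizing v w
  · exact (this hw hv (le_of_not_ge hvw)).comp measurable_id measurable_swap
  have hmono : Monotone ![a, b, v, w] := by
    refine Fin.monotone_iff_le_succ.2 fun i ↦ ?_
    fin_cases i <;> simpa
  have h := hB.indep_increments 3 ![a, b, v, w] hmono
  have h' := h.indepFun_prodMk₀ (fun i ↦ hB.aemeasurable_sub _ _) 1 2 0 (by decide) (by decide)
  have h2 := h'.symm.comp (φ := id)
    (ψ := fun p : EuclideanSpace ℝ (Fin d) × EuclideanSpace ℝ (Fin d) ↦ (p.1, p.1 + p.2))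
    measurable_id (by fun_prop)
  refine h2.congr (.of_forall fun ω ↦ rfl) (.of_forall fun ω ↦ Prod.ext rfl ?_)
  change (B v ω - B b ω) + (B w ω - B v ω) = B w ω - B b ω
  abel

theorem indepFun_sub_past (hB : IsBrownianMotion B P) {a b v w : unitInterval} (hab : a ≤ b)
    (hv : v ≤ a) (hw : w ≤ a) :
    IndepFun (fun ω ↦ B b ω - B a ω) (fun ω ↦ (B a ω - B v ω, B a ω - B w ω)) P := by
  wlog hvw : v ≤ w generalizing v w
  · exact (this hw hv (le_of_not_ge hvw)).comp measurable_id measurable_swap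
  have hmono : Monotone ![v, w, a, b] := by
    refine Fin.monotone_iff_le_succ.2 fun i ↦ ?_
    fin_cases i <;> simpa
  have h := hB.indep_increments 3 ![v, w, a, b] hmono
  have h' := h.indepFun_prodMk₀ (fun i ↦ hB.aemeasurable_sub _ _) 0 1 2 (by decide) (by decide)
  have h2 := h'.symm.comp (φ := id)
    (ψ := fun p : EuclideanSpace ℝ (Fin d) × EuclideanSpace ℝ (Fin d) ↦ (p.1 + p.2, p.2))
    measurable_id (by fun_prop)
  refine h2.congr (.of_forall fun ω ↦ rfl) (.of_forall fun ω ↦ Prod.ext ?_ rfl)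
  change (B w ω - B v ω) + (B a ω - B w ω) = B a ω - B v ω
  abel

/-- The increment over [s, s'] is independent of everything after s', so it must hit a ball whose
centre is determined by the future. The companion bound detaches the last increment in the same way.
-/
theorem measure_closeEvent_inter_le_left [IsProbabilityMeasure P] (hB : IsBrownianMotion B P)
    {m : ℕ} (hm : m ≤ d) {r : ℝ} (hr : 0 < r) {s t s' t' : unitInterval} (hs : s ≤ s') (ht : s' ≤ t) (ht' : s' ≤ t') :
    P (closeEvent B r s t ∩ closeEvent B r s' t') ≤
      hitBound m r (s' - s) * P (closeEvent B r s' t') := by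
  have := (hB.indepFun_sub_future hs ht ht').measure_norm_add_le_inter_le
    (hB.aemeasurable_sub _ _) (hB.aemeasurable_sub _ _) (hB.aemeasurable_sub _ _)
    (hB.map_sub_closedBall_le hm hs hr)
  simpa [closeEvent] using this

theorem measure_closeEvent_inter_le_right [IsProbabilityMeasure P] (hB : IsBrownianMotion B P)
    {m : ℕ} (hm : m ≤ d) {r : ℝ} (hr : 0 < r) {s t s' t' : unitInterval} (hs : s ≤ t) (hs' : s' ≤ t) (ht : t ≤ t') :
    P (closeEvent B r s t ∩ closeEvent B r s' t') ≤
      hitBound m r (t' - t) * P (closeEvent B r s t) := by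
  have := (hB.indepFun_sub_past ht hs' hs).measure_norm_add_le_inter_le
    (hB.aemeasurable_sub _ _) (hB.aemeasurable_sub _ _) (hB.aemeasurable_sub _ _)
    (hB.map_sub_closedBall_le hm ht hr)
  rw [inter_comm]
  simpa [closeEvent] using this

theorem measure_closeEvent_inter_eq (hB : IsBrownianMotion B P)
    {r : ℝ} {s t s' t' : unitInterval} (hs : s ≤ t) (hts : t ≤ s') (hs' : s' ≤ t') :
    P (closeEvent B r s t ∩ closeEvent B r s' t') =
      P (closeEvent B r s t) * P (closeEvent B r s' t') := by
  have hmono : Monotone ![s, t, s', t'] := by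
    refine Fin.monotone_iff_le_succ.2 fun i ↦ ?_
    fin_cases i <;> simpa
  have h := (hB.indep_increments 3 ![s, t, s', t'] hmono).indepFun (i := 0) (j := 2) (by decide)
  exact h.measure_inter_preimage_eq_mul {x | ‖x‖ ≤ r} {x | ‖x‖ ≤ r}
    (measurableSet_le (by fun_prop) (by fun_prop)) (measurableSet_le (by fun_prop) (by fun_prop))

/-- Fubini needs joint measurability, whereas each `B t` is measurable only up to its own null set.
Agreement with measurable versions on a countable dense set of times, together with continuity,
costs a single null set, on which the path is replaced by 0. -/
theorem exists_modification (hB : IsBrownianMotion B P) :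
    ∃ B' : unitInterval → Ω → EuclideanSpace ℝ (Fin d),
      Measurable (fun p : unitInterval × Ω ↦ B' p.1 p.2) ∧ (∀ᵐ ω ∂P, ∀ t, B' t ω = B t ω) := by
  obtain ⟨D, hDc, hDd⟩ := TopologicalSpace.exists_countable_dense unitInterval
  have hgood : ∀ᵐ ω ∂P, Continuous (fun t ↦ B t ω) ∧
      ∀ t ∈ D, B t ω = (hB.aemeasurable t).mk _ ω := by
    refine hB.continuous_paths.and ((ae_ball_iff hDc).2 fun t _ ↦ (hB.aemeasurable t).ae_eq_mk)
  obtain ⟨N, hNs, hNm, hN0⟩ := exists_measurable_superset_of_null (ae_iff.1 hgood)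
  have hN : ∀ ω, ω ∉ N → Continuous (fun t ↦ B t ω) ∧
      ∀ t ∈ D, B t ω = (hB.aemeasurable t).mk _ ω := fun ω hω ↦ by
    by_contra hcon
    exact hω (hNs hcon)
  refine ⟨fun t ↦ Nᶜ.indicator (B t), ?_, ?_⟩
  · have hcont : ∀ ω, Continuous fun t ↦ Nᶜ.indicator (B t) ω := by
      intro ω
      by_cases hω : ω ∈ N
      · simpa [hω] using continuous_const
      · simpa [hω] using (hN ω hω).1
    have hmeasD : ∀ t ∈ D, Measurable (Nᶜ.indicator (B t)) := by
      intro t ht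
      have : Nᶜ.indicator (B t) = Nᶜ.indicator ((hB.aemeasurable t).mk _) :=
        indicator_congr fun ω hω ↦ (hN ω hω).2 t ht
      rw [this]
      exact (hB.aemeasurable t).measurable_mk.indicator hNm.compl
    refine measurable_uncurry_of_continuous_of_measurable (u := fun t ↦ Nᶜ.indicator (B t))
      hcont fun t ↦ ?_
    obtain ⟨x, hxD, hx⟩ := mem_closure_iff_seq_limit.1 (hDd t)
    exact measurable_of_tendsto_metrizable (fun n ↦ hmeasD _ (hxD n))
      (tendsto_pi_nhds.2 fun ω ↦ ((hcont ω).tendsto t).comp hx)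
  · filter_upwards [compl_mem_ae_iff.2 hN0] with ω hω t
    exact indicator_of_mem hω _

theorem congr (hB : IsBrownianMotion B P) {B' : unitInterval → Ω → EuclideanSpace ℝ (Fin d)}
    (h : ∀ᵐ ω ∂P, ∀ t, B' t ω = B t ω) : IsBrownianMotion B' P where
  start_zero := by
    filter_upwards [h, hB.start_zero] with ω h1 h2
    rw [h1, h2]
  indep_increments := fun n t ht ↦ (hB.indep_increments n t ht).congr fun i ↦ by
    filter_upwards [h] with ω hω
    rw [hω, hω]
  law_increments := fun s t hst ↦ (hB.law_increments s t hst).congr <| by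
    filter_upwards [h] with ω hω
    rw [hω, hω]
  continuous_paths := by
    filter_upwards [h, hB.continuous_paths] with ω h1 h2
    simpa [h1] using h2

end IsBrownianMotion

end

/-! ### Time integrals of the hitting bounds. -/

theorem lintegral_unitInterval_dist_le {h : ℝ → ℝ≥0∞} (hh : Measurable h) (s : unitInterval) :
    ∫⁻ t : unitInterval, h (dist s t) ≤ 2 * ∫⁻ u in Ioc (0 : ℝ) 1, h u := by
  set k : ℝ → ℝ≥0∞ := (Ioc (0 : ℝ) 1).indicator h with hk
  have hkm : Measurable k := hh.indicator measurableSet_Ioc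
  have e1 : ∫⁻ t : unitInterval, h (dist s t) = ∫⁻ x in Icc (0 : ℝ) 1, h |(s : ℝ) - x| :=
    lintegral_subtype_comap measurableSet_Icc fun x ↦ h |(s : ℝ) - x|
  have hne : ∀ᵐ x : ℝ, x ≠ s := by simp [ae_iff]
  rw [e1, ← lintegral_indicator measurableSet_Icc, ← lintegral_indicator measurableSet_Ioc]
  calc ∫⁻ x, (Icc (0 : ℝ) 1).indicator (fun x ↦ h |(s : ℝ) - x|) x
      ≤ ∫⁻ x, (k (x - s) + k (s - x)) := by
        refine lintegral_mono_ae ?_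
        filter_upwards [hne] with x hx
        refine indicator_apply_le' (fun hx1 ↦ ?_) (fun _ ↦ zero_le)
        rcases hx.lt_or_gt with hlt | hlt
        · have : (s : ℝ) - x ∈ Ioc (0 : ℝ) 1 := ⟨by linarith, by linarith [hx1.1, s.2.2]⟩
          simp only [hk, indicator_of_mem this, abs_of_pos this.1]
          exact le_add_self
        · have : x - (s : ℝ) ∈ Ioc (0 : ℝ) 1 := ⟨by linarith, by linarith [hx1.2, s.2.1]⟩
          simp only [hk, indicator_of_mem this, abs_sub_comm (s : ℝ), abs_of_pos this.1]
          exact le_self_add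
    _ = 2 * ∫⁻ u, k u := by
        rw [lintegral_add_left (by fun_prop), lintegral_sub_right_eq_self k,
          lintegral_sub_left_eq_self k, two_mul]

theorem lintegral_rpow_neg_Ioc_le {α : ℝ} (hα : α < 1) :
    ∫⁻ u in Ioc (0 : ℝ) 1, ENNReal.ofReal u ^ (-α) ≤ ENNReal.ofReal (1 / (1 - α)) := by
  have hint : IntervalIntegrable (fun u : ℝ ↦ u ^ (-α)) volume 0 1 :=
    intervalIntegral.intervalIntegrable_rpow' (by linarith)
  rw [intervalIntegrable_iff_integrableOn_Ioc_of_le zero_le_one] at hint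
  have e : ∫⁻ u in Ioc (0 : ℝ) 1, ENNReal.ofReal u ^ (-α) =
      ∫⁻ u in Ioc (0 : ℝ) 1, ENNReal.ofReal (u ^ (-α)) :=
    setLIntegral_congr_fun measurableSet_Ioc fun u hu ↦ ENNReal.ofReal_rpow_of_pos hu.1
  rw [e, ← ofReal_integral_eq_lintegral_ofReal hint, ← intervalIntegral.integral_of_le zero_le_one,
    integral_rpow (Or.inl (by linarith))]
  · refine ENNReal.ofReal_le_ofReal (le_of_eq ?_)
    rw [Real.zero_rpow (by linarith), Real.one_rpow]
    ring
  · filter_upwards [ae_restrict_mem measurableSet_Ioc] with u hu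
    exact Real.rpow_nonneg hu.1.le _

theorem hitBound_two_le (r : ℝ) (u : ℝ) :
    hitBound 2 r u ≤ ENNReal.ofReal (r ^ 2) * (ENNReal.ofReal u)⁻¹ := by
  refine (min_le_right _ _).trans ?_
  rcases le_or_gt r 0 with hr | hr
  · simp [ENNReal.ofReal_of_nonpos hr]
  rw [mul_pow, ENNReal.ofReal_pow hr.le, ← ENNReal.rpow_natCast (_ ^ _), ← ENNReal.rpow_mul,
    ← ENNReal.rpow_neg_one]
  norm_num

theorem hitBound_three_le {r : ℝ} (hr : 0 < r) (u : ℝ) :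
    hitBound 3 r u ≤ ENNReal.ofReal (r ^ 3) * ENNReal.ofReal u ^ (-(3 / 2) : ℝ) := by
  refine (min_le_right _ _).trans ?_
  rw [mul_pow, ENNReal.ofReal_pow hr.le, ← ENNReal.rpow_natCast (_ ^ _), ← ENNReal.rpow_mul]
  norm_num

/-- The two terms of the minimum cross at u = r²; below it the bound 1 is used. -/
theorem lintegral_hitBound_Ioc_le_add (m : ℕ) {r : ℝ} (hr1 : r ≤ 1) (hr : 0 < r) :
    ∫⁻ u in Ioc (0 : ℝ) 1, hitBound m r u ≤
      ENNReal.ofReal (r ^ 2) + ∫⁻ u in Ioc (r ^ 2) 1, hitBound m r u := by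
  have hr2 : r ^ 2 ≤ 1 := by nlinarith
  rw [← Ioc_union_Ioc_eq_Ioc (sq_nonneg r) hr2,
    lintegral_union measurableSet_Ioc (Ioc_disjoint_Ioc_of_le le_rfl)]
  gcongr
  calc ∫⁻ u in Ioc 0 (r ^ 2), hitBound m r u ≤ ∫⁻ u in Ioc 0 (r ^ 2), 1 :=
        lintegral_mono fun u ↦ hitBound_le_one _ _ _
    _ = ENNReal.ofReal (r ^ 2) := by simp

theorem lintegral_hitBound_two_le {r : ℝ} (hr : 0 < r) (hr1 : r ≤ 1) :
    ∫⁻ u in Ioc (0 : ℝ) 1, hitBound 2 r u ≤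
      ENNReal.ofReal (r ^ 2 * (1 + 2 * Real.log (1 / r))) := by
  have hr2 : r ^ 2 ≤ 1 := by nlinarith
  have hr0 : 0 < r ^ 2 := by positivity
  have hlog : 0 ≤ Real.log (1 / r) := Real.log_nonneg (by rw [le_div_iff₀ hr]; linarith)
  refine (lintegral_hitBound_Ioc_le_add 2 hr1 hr).trans ?_
  have hint : IntervalIntegrable (fun u : ℝ ↦ r ^ 2 * u⁻¹) volume (r ^ 2) 1 := by
    refine ContinuousOn.intervalIntegrable (ContinuousOn.mul continuousOn_const ?_)
    refine continuousOn_inv₀.mono fun u hu ↦ ?_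
    rw [uIcc_of_le hr2] at hu
    exact (hr0.trans_le hu.1).ne'
  rw [intervalIntegrable_iff_integrableOn_Ioc_of_le hr2] at hint
  have e : ∫⁻ u in Ioc (r ^ 2) 1, hitBound 2 r u ≤
      ∫⁻ u in Ioc (r ^ 2) 1, ENNReal.ofReal (r ^ 2 * u⁻¹) := by
    refine setLIntegral_mono' measurableSet_Ioc fun u hu ↦ ?_
    rw [ENNReal.ofReal_mul hr0.le, ENNReal.ofReal_inv_of_pos (hr0.trans hu.1)]
    exact hitBound_two_le r u
  refine (add_le_add_right e _).trans ?_
  rw [← ofReal_integral_eq_lintegral_ofReal hint, ← intervalIntegral.integral_of_le hr2,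
    intervalIntegral.integral_const_mul, integral_inv_of_pos hr0 one_pos,
    ← ENNReal.ofReal_add hr0.le]
  · refine ENNReal.ofReal_le_ofReal (le_of_eq ?_)
    rw [show 1 / r ^ 2 = (1 / r) ^ 2 by ring, Real.log_pow]
    push_cast
    ring
  · rw [show 1 / r ^ 2 = (1 / r) ^ 2 by ring, Real.log_pow]
    positivity
  · filter_upwards [ae_restrict_mem measurableSet_Ioc] with u hu
    have := hr0.trans hu.1
    positivity

theorem lintegral_hitBound_three_le {r : ℝ} (hr : 0 < r) (hr1 : r ≤ 1) :
    ∫⁻ u in Ioc (0 : ℝ) 1, hitBound 3 r u ≤ ENNReal.ofReal (3 * r ^ 2) := by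
  have hr2 : r ^ 2 ≤ 1 := by nlinarith
  have hr0 : 0 < r ^ 2 := by positivity
  refine (lintegral_hitBound_Ioc_le_add 3 hr1 hr).trans ?_
  have h0 : (0 : ℝ) ∉ uIcc (r ^ 2) 1 := by
    rw [uIcc_of_le hr2]
    exact fun h ↦ absurd h.1 (not_le.2 hr0)
  have hint : IntervalIntegrable (fun u : ℝ ↦ r ^ 3 * u ^ (-(3 / 2) : ℝ)) volume (r ^ 2) 1 :=
    (intervalIntegral.intervalIntegrable_rpow (Or.inr h0)).const_mul _
  rw [intervalIntegrable_iff_integrableOn_Ioc_of_le hr2] at hint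
  have e : ∫⁻ u in Ioc (r ^ 2) 1, hitBound 3 r u ≤
      ∫⁻ u in Ioc (r ^ 2) 1, ENNReal.ofReal (r ^ 3 * u ^ (-(3 / 2) : ℝ)) := by
    refine setLIntegral_mono' measurableSet_Ioc fun u hu ↦ ?_
    rw [ENNReal.ofReal_mul (by positivity), ← ENNReal.ofReal_rpow_of_pos (hr0.trans hu.1)]
    exact hitBound_three_le hr u
  refine (add_le_add_right e _).trans ?_
  have hval : ∫ u in (r ^ 2)..1, r ^ 3 * u ^ (-(3 / 2) : ℝ) = 2 * r ^ 2 - 2 * r ^ 3 := by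
    rw [intervalIntegral.integral_const_mul, integral_rpow (Or.inr ⟨by norm_num, h0⟩)]
    have : (r ^ 2) ^ (-(3 / 2) + 1 : ℝ) = r⁻¹ := by
      rw [← Real.rpow_natCast r 2, ← Real.rpow_mul hr.le, ← Real.rpow_neg_one]
      norm_num
    rw [this, Real.one_rpow]
    field_simp
    ring
  rw [← ofReal_integral_eq_lintegral_ofReal hint, ← intervalIntegral.integral_of_le hr2, hval,
    ← ENNReal.ofReal_add hr0.le]
  · refine ENNReal.ofReal_le_ofReal ?_
    have : 0 < r ^ 3 := by positivity
    linarith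
  · nlinarith
  · filter_upwards [ae_restrict_mem measurableSet_Ioc] with u hu
    have := hr0.trans hu.1
    positivity

/-! ### Chebyshev's inequality and moments of slice measures. -/

section

variable {Ω : Type*} [MeasurableSpace Ω] {P : Measure Ω} [IsProbabilityMeasure P]

/-- Chebyshev's inequality, with the variance bound written additively because subtraction in `ℝ≥0∞`
is truncated. -/
theorem measure_lintegral_add_le_le_div_sq {Y : Ω → ℝ≥0∞} (hY : Measurable Y) (hY1 : ∀ ω, Y ω ≤ 1)
    {V c : ℝ≥0∞} (hc0 : c ≠ 0) (hc : c ≠ ∞)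
    (hV : ∫⁻ ω, Y ω ^ 2 ∂P ≤ (∫⁻ ω, Y ω ∂P) ^ 2 + V) :
    P {ω | ∫⁻ ω, Y ω ∂P + c ≤ Y ω} ≤ V / c ^ 2 := by
  have hYt : ∀ ω, Y ω ≠ ∞ := fun ω ↦ ((hY1 ω).trans_lt ENNReal.one_lt_top).ne
  have hI : ∫⁻ ω, Y ω ∂P ≤ 1 := (lintegral_mono hY1).trans (by simp)
  have hIt : ∫⁻ ω, Y ω ∂P ≠ ∞ := (hI.trans_lt ENNReal.one_lt_top).ne
  set X : Ω → ℝ := fun ω ↦ (Y ω).toReal with hX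
  have hXm : Measurable X := hY.ennreal_toReal
  have hX2 : MemLp X 2 P := by
    refine MemLp.of_bound hXm.aestronglyMeasurable 1 (.of_forall fun ω ↦ ?_)
    rw [Real.norm_of_nonneg ENNReal.toReal_nonneg]
    exact ENNReal.toReal_le_of_le_ofReal zero_le_one (by simpa using hY1 ω)
  have hEX : P[X] = (∫⁻ ω, Y ω ∂P).toReal :=
    integral_toReal hY.aemeasurable (.of_forall fun ω ↦ (hYt ω).lt_top)
  have hEX2 : P[X ^ 2] = (∫⁻ ω, Y ω ^ 2 ∂P).toReal := by
    rw [← integral_toReal (by fun_prop) (.of_forall fun ω ↦ (ENNReal.pow_ne_top (hYt ω)).lt_top)]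
    simp [hX]
  have hvar : ENNReal.ofReal (variance X P) ≤ V := by
    rcases eq_or_ne V ∞ with rfl | hVt
    · exact le_top
    have h1 := ENNReal.toReal_mono (ENNReal.add_ne_top.2 ⟨ENNReal.pow_ne_top hIt, hVt⟩) hV
    rw [ENNReal.toReal_add (ENNReal.pow_ne_top hIt) hVt, ENNReal.toReal_pow] at h1
    rw [variance_eq_sub hX2, hEX, hEX2, ENNReal.ofReal_le_iff_le_toReal hVt]
    linarith
  have hcr : 0 < c.toReal := ENNReal.toReal_pos hc0 hc
  calc P {ω | ∫⁻ ω, Y ω ∂P + c ≤ Y ω} ≤ P {ω | c.toReal ≤ |X ω - P[X]|} := by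
        refine measure_mono fun ω hω ↦ ?_
        have h1 := ENNReal.toReal_mono (hYt ω) hω
        rw [ENNReal.toReal_add hIt hc, ← hEX] at h1
        exact (le_sub_iff_add_le'.2 h1).trans (le_abs_self _)
    _ ≤ ENNReal.ofReal (variance X P / c.toReal ^ 2) := meas_ge_le_variance_div_sq hX2 hcr
    _ ≤ V / c ^ 2 := by
        rw [ENNReal.ofReal_div_of_pos (by positivity), ENNReal.ofReal_pow hcr.le,
          ENNReal.ofReal_toReal hc]
        gcongr

variable {Z : Type*} [MeasurableSpace Z] {ν : Measure Z} [SFinite ν]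

theorem lintegral_measure_slice {S : Set (Z × Ω)} (hS : MeasurableSet S) :
    ∫⁻ ω, ν {z | (z, ω) ∈ S} ∂P = ∫⁻ z, P {ω | (z, ω) ∈ S} ∂ν := by
  have h1 := Measure.prod_apply (μ := ν) (ν := P) hS
  have h2 := Measure.prod_apply_symm (μ := ν) (ν := P) hS
  exact h2.symm.trans h1

theorem lintegral_measure_slice_sq {S : Set (Z × Ω)} (hS : MeasurableSet S) :
    ∫⁻ ω, ν {z | (z, ω) ∈ S} ^ 2 ∂P =
      ∫⁻ z, ∫⁻ z', P ({ω | (z, ω) ∈ S} ∩ {ω | (z', ω) ∈ S}) ∂ν ∂ν := by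
  set S₂ : Set ((Z × Z) × Ω) := {p | (p.1.1, p.2) ∈ S ∧ (p.1.2, p.2) ∈ S} with hS₂
  have hS₂m : MeasurableSet S₂ :=
    MeasurableSet.inter (s₁ := {p : (Z × Z) × Ω | (p.1.1, p.2) ∈ S})
      (s₂ := {p : (Z × Z) × Ω | (p.1.2, p.2) ∈ S})
      (hS.preimage (by fun_prop)) (hS.preimage (by fun_prop))
  have h := lintegral_measure_slice (P := P) (ν := ν.prod ν) hS₂m
  have h' := lintegral_prod (μ := ν) (ν := ν) _ (measurable_measure_prodMk_left (ν := P) hS₂m).aemeasurable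
  rw [show (∫⁻ ω, ν {z | (z, ω) ∈ S} ^ 2 ∂P) = ∫⁻ ω, (ν.prod ν) {z | (z, ω) ∈ S₂} ∂P from ?_, h]
  · exact h'
  · refine lintegral_congr fun ω ↦ ?_
    rw [sq, ← Measure.prod_prod]
    rfl

end

theorem lintegral_lintegral_add_swap {Z : Type*} [MeasurableSpace Z] {ν : Measure Z} [SFinite ν]
    {M : Z → Z → ℝ≥0∞} (hM : Measurable (Function.uncurry M)) :
    ∫⁻ z, ∫⁻ z', (M z z' + M z' z) ∂ν ∂ν = 2 * ∫⁻ z, ∫⁻ z', M z z' ∂ν ∂ν := by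
  have h1 : ∀ z, Measurable fun z' ↦ M z z' := fun z ↦ hM.comp measurable_prodMk_left
  simp_rw [lintegral_add_left (h1 _)]
  rw [lintegral_add_left (Measurable.lintegral_prod_right hM), two_mul,
    lintegral_lintegral_swap (f := fun z z' ↦ M z' z) (hM.comp measurable_swap).aemeasurable]

/-- The power x⁻¹ just fails to be integrable at 0. Moving an eighth of it onto a smaller quantity
leaves an integrable power of x. -/
theorem ENNReal.inv_le_rpow_mul_rpow {x y : ℝ≥0∞} (h : y ≤ x) :
    x⁻¹ ≤ x ^ (-(7 / 8) : ℝ) * y ^ (-(1 / 8) : ℝ) := by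
  rcases eq_or_ne x 0 with rfl | hx0
  · simp [nonpos_iff_eq_zero.1 h]
  rcases eq_or_ne x ∞ with rfl | hxt
  · simp
  calc x⁻¹ = x ^ (-(7 / 8) : ℝ) * x ^ (-(1 / 8) : ℝ) := by
        rw [← ENNReal.rpow_add _ _ hx0 hxt, ← ENNReal.rpow_neg_one]
        norm_num
    _ ≤ x ^ (-(7 / 8) : ℝ) * y ^ (-(1 / 8) : ℝ) := by
        rw [ENNReal.rpow_neg x (1 / 8), ENNReal.rpow_neg y]
        gcongr

theorem ENNReal.rpow_mul_self_le {x : ℝ≥0∞} (h : x ≤ 1) :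
    x ^ (-(1 / 8) : ℝ) * x ^ (-(1 / 8) : ℝ) ≤ x ^ (-(7 / 8) : ℝ) := by
  rcases eq_or_ne x 0 with rfl | hx0
  · simp
  rw [← ENNReal.rpow_add _ _ hx0 (h.trans_lt ENNReal.one_lt_top).ne]
  exact ENNReal.rpow_le_rpow_of_exponent_ge h (by norm_num)

/-! ### Short pairs by variance, and long pairs by the first moment. -/

theorem unitInterval.dist_eq_sub {s t : unitInterval} (h : s ≤ t) :
    dist s t = (t : ℝ) - s := by
  rw [dist_comm, Subtype.dist_eq, Real.dist_eq,
    abs_of_nonneg (sub_nonneg.2 (Subtype.coe_le_coe.2 h))]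

theorem unitInterval.dist_le_one (s t : unitInterval) : dist s t ≤ 1 := by
  rw [Subtype.dist_eq, Real.dist_eq, abs_le]
  constructor <;> linarith [s.2.1, s.2.2, t.2.1, t.2.2]

/-- The pairs of times `s ≤ t` at distance at most `g`. -/
def shortPairs (g : ℝ) : Set (unitInterval × unitInterval) :=
  {z | z.1 ≤ z.2 ∧ dist z.1 z.2 ≤ g}

/-- The pairs of times `s ≤ t` at distance more than `g`. -/
def longPairs (g : ℝ) : Set (unitInterval × unitInterval) :=
  {z | z.1 ≤ z.2 ∧ g < dist z.1 z.2}

theorem measurableSet_shortPairs (g : ℝ) : MeasurableSet (shortPairs g) :=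
  (measurableSet_le measurable_fst measurable_snd).inter
    (measurableSet_le (measurable_fst.dist measurable_snd) measurable_const)

theorem measurableSet_longPairs (g : ℝ) : MeasurableSet (longPairs g) :=
  (measurableSet_le measurable_fst measurable_snd).inter
    (measurableSet_lt measurable_const (measurable_fst.dist measurable_snd))

theorem volume_shortPairs_le (g : ℝ) : volume (shortPairs g) ≤ ENNReal.ofReal g := by
  rw [Measure.volume_eq_prod, Measure.prod_apply (measurableSet_shortPairs g)]
  calc ∫⁻ s, volume (Prod.mk s ⁻¹' shortPairs g) ≤ ∫⁻ s : unitInterval, ENNReal.ofReal g := by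
        refine lintegral_mono fun s ↦ ?_
        rw [Measure.Subtype.volume_def, comap_subtype_coe_apply measurableSet_Icc]
        calc volume (Subtype.val '' (Prod.mk s ⁻¹' shortPairs g))
            ≤ volume (Icc (s : ℝ) (s + g)) := by
              refine measure_mono ?_
              rintro _ ⟨t, ⟨h1, h2⟩, rfl⟩
              rw [unitInterval.dist_eq_sub h1] at h2
              simp only at h1 h2
              exact ⟨h1, by linarith⟩
          _ = ENNReal.ofReal g := by simp
    _ = ENNReal.ofReal g := by simp

section

variable {Ω : Type*} {d : ℕ}
  {B : unitInterval → Ω → EuclideanSpace ℝ (Fin d)}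

/-- The amount of pairs of times in `A` between which the process moves by at most `r`. -/
noncomputable def closeTime (B : unitInterval → Ω → EuclideanSpace ℝ (Fin d)) (r : ℝ)
    (A : Set (unitInterval × unitInterval)) (ω : Ω) : ℝ≥0∞ :=
  volume.restrict A {z | ω ∈ closeEvent B r z.1 z.2}

theorem closeTime_le_one (r : ℝ) (A : Set (unitInterval × unitInterval)) (ω : Ω) :
    closeTime B r A ω ≤ 1 :=
  (Measure.restrict_apply_le _ _).trans prob_le_one

variable [MeasurableSpace Ω] {P : Measure Ω}

theorem measurableSet_closeEvent_prod (hm : Measurable fun p : unitInterval × Ω ↦ B p.1 p.2)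
    (r : ℝ) : MeasurableSet {p : (unitInterval × unitInterval) × Ω |
      p.2 ∈ closeEvent B r p.1.1 p.1.2} := by
  have h1 : Measurable fun p : (unitInterval × unitInterval) × Ω ↦ B p.1.1 p.2 :=
    hm.comp (by fun_prop : Measurable fun p : (unitInterval × unitInterval) × Ω ↦ (p.1.1, p.2))
  have h2 : Measurable fun p : (unitInterval × unitInterval) × Ω ↦ B p.1.2 p.2 :=
    hm.comp (by fun_prop : Measurable fun p : (unitInterval × unitInterval) × Ω ↦ (p.1.2, p.2))
  exact measurableSet_le (h2.sub h1).norm measurable_const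

theorem measurable_closeTime (hm : Measurable fun p : unitInterval × Ω ↦ B p.1 p.2) (r : ℝ)
    (A : Set (unitInterval × unitInterval)) : Measurable (closeTime B r A) :=
  measurable_measure_prodMk_right (measurableSet_closeEvent_prod hm r)

theorem measurable_measure_closeEvent [SFinite P]
    (hm : Measurable fun p : unitInterval × Ω ↦ B p.1 p.2) (r : ℝ) :
    Measurable fun z : unitInterval × unitInterval ↦ P (closeEvent B r z.1 z.2) :=
  measurable_measure_prodMk_left (measurableSet_closeEvent_prod hm r)

theorem IsBrownianMotion.measure_closeEvent_le_dist (hB : IsBrownianMotion B P) {m : ℕ} (hmd : m ≤ d)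
    {s t : unitInterval} (hst : s ≤ t) {r : ℝ} (hr : 0 < r) :
    P (closeEvent B r s t) ≤ hitBound m r (dist s t) := by
  rw [unitInterval.dist_eq_sub hst]
  exact hB.measure_closeEvent_le hmd hst hr

variable [IsProbabilityMeasure P]

theorem lintegral_closeTime (hm : Measurable fun p : unitInterval × Ω ↦ B p.1 p.2) (r : ℝ)
    (A : Set (unitInterval × unitInterval)) :
    ∫⁻ ω, closeTime B r A ω ∂P = ∫⁻ z in A, P (closeEvent B r z.1 z.2) :=
  lintegral_measure_slice (measurableSet_closeEvent_prod hm r)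

theorem lintegral_closeTime_sq (hm : Measurable fun p : unitInterval × Ω ↦ B p.1 p.2) (r : ℝ)
    (A : Set (unitInterval × unitInterval)) :
    ∫⁻ ω, closeTime B r A ω ^ 2 ∂P =
      ∫⁻ z in A, ∫⁻ z' in A, P (closeEvent B r z.1 z.2 ∩ closeEvent B r z'.1 z'.2) :=
  lintegral_measure_slice_sq (measurableSet_closeEvent_prod hm r)

namespace IsBrownianMotion

/-- Disjoint intervals give the product exactly. For overlapping ones, the increment between the two
left endpoints is detached. The bound is symmetrised so that the order of s and s' need not be
recorded. -/
theorem measure_closeEvent_inter_le_add (hB : IsBrownianMotion B P) {m : ℕ} (hmd : m ≤ d)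
    {r : ℝ} (hr : 0 < r) {s t s' t' : unitInterval} (hst : s ≤ t) (hst' : s' ≤ t') :
    P (closeEvent B r s t ∩ closeEvent B r s' t') ≤
      P (closeEvent B r s t) * P (closeEvent B r s' t') +
        (hitBound m r (dist s s') * hitBound m r (dist s' t') +
          hitBound m r (dist s' s) * hitBound m r (dist s t)) := by
  wlog hss : s ≤ s' generalizing s t s' t'
  · rw [inter_comm, mul_comm (P _), add_comm (hitBound m r _ * _)]
    exact this hst' hst (le_of_not_ge hss)
  rcases le_total t s' with h | h
  · exact (hB.measure_closeEvent_inter_eq hst h hst').le.trans le_self_add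
  · refine (hB.measure_closeEvent_inter_le_left hmd hr hss h hst').trans ?_
    rw [← unitInterval.dist_eq_sub hss]
    refine le_trans ?_ (le_self_add.trans le_add_self)
    gcongr
    exact hB.measure_closeEvent_le_dist hmd hst' hr

theorem lintegral_closeTime_le (hB : IsBrownianMotion B P)
    (hm : Measurable fun p : unitInterval × Ω ↦ B p.1 p.2) {m : ℕ} (hmd : m ≤ d)
    {r : ℝ} (hr : 0 < r) {Q : ℝ≥0∞}
    (hQ : ∀ s : unitInterval, ∫⁻ t : unitInterval, hitBound m r (dist s t) ≤ Q) (g : ℝ) :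
    ∫⁻ ω, closeTime B r (shortPairs g) ω ∂P ≤ Q := by
  have hq := measurable_hitBound m r
  rw [lintegral_closeTime hm]
  calc ∫⁻ z in shortPairs g, P (closeEvent B r z.1 z.2)
      ≤ ∫⁻ z in shortPairs g, hitBound m r (dist z.1 z.2) :=
        setLIntegral_mono' (measurableSet_shortPairs g) fun z hz ↦
          hB.measure_closeEvent_le_dist hmd hz.1 hr
    _ ≤ ∫⁻ z : unitInterval × unitInterval, hitBound m r (dist z.1 z.2) :=
        setLIntegral_le_lintegral _ _
    _ = ∫⁻ s : unitInterval, ∫⁻ t : unitInterval, hitBound m r (dist s t) :=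
        lintegral_prod (μ := volume) (ν := volume) _ (by fun_prop)
    _ ≤ ∫⁻ _ : unitInterval, Q := lintegral_mono fun s ↦ hQ s
    _ = Q := by simp

/-- The product term integrates to the squared mean. In the correction, integrating out t' and then
s' gives Q each time, and the remaining pair ranges over a set of measure at most g. -/
theorem lintegral_closeTime_sq_le (hB : IsBrownianMotion B P)
    (hm : Measurable fun p : unitInterval × Ω ↦ B p.1 p.2) {m : ℕ} (hmd : m ≤ d)
    {r : ℝ} (hr : 0 < r) {Q : ℝ≥0∞}
    (hQ : ∀ s : unitInterval, ∫⁻ t : unitInterval, hitBound m r (dist s t) ≤ Q) (g : ℝ) :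
    ∫⁻ ω, closeTime B r (shortPairs g) ω ^ 2 ∂P ≤
      (∫⁻ ω, closeTime B r (shortPairs g) ω ∂P) ^ 2 + 2 * (ENNReal.ofReal g * Q ^ 2) := by
  have hq := measurable_hitBound m r
  set A := shortPairs g with hA
  have hAm : MeasurableSet A := measurableSet_shortPairs g
  set K : unitInterval × unitInterval → unitInterval × unitInterval → ℝ≥0∞ :=
    fun z z' ↦ hitBound m r (dist z.1 z'.1) * hitBound m r (dist z'.1 z'.2) with hK
  have hKm : Measurable (Function.uncurry K) := by unfold Function.uncurry; fun_prop
  have hpm := measurable_measure_closeEvent (P := P) hm r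
  have hKint : ∀ z, ∫⁻ z' in A, K z z' ≤ Q ^ 2 := by
    intro z
    calc ∫⁻ z' in A, K z z' ≤ ∫⁻ z', K z z' := setLIntegral_le_lintegral _ _
      _ = ∫⁻ s' : unitInterval, ∫⁻ t' : unitInterval,
            hitBound m r (dist z.1 s') * hitBound m r (dist s' t') :=
          lintegral_prod (μ := volume) (ν := volume) _ (by fun_prop)
      _ ≤ ∫⁻ s' : unitInterval, hitBound m r (dist z.1 s') * Q := by
          refine lintegral_mono fun s' ↦ ?_
          rw [lintegral_const_mul _ (by fun_prop)]
          gcongr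
          exact hQ s'
      _ ≤ Q ^ 2 := by
          rw [lintegral_mul_const _ (by fun_prop), sq]
          gcongr
          exact hQ _
  rw [lintegral_closeTime_sq hm, lintegral_closeTime hm]
  calc ∫⁻ z in A, ∫⁻ z' in A, P (closeEvent B r z.1 z.2 ∩ closeEvent B r z'.1 z'.2)
      ≤ ∫⁻ z in A, ∫⁻ z' in A, (P (closeEvent B r z.1 z.2) * P (closeEvent B r z'.1 z'.2) +
          (K z z' + K z' z)) :=
        setLIntegral_mono' hAm fun z hz ↦ setLIntegral_mono' hAm fun z' hz' ↦
          hB.measure_closeEvent_inter_le_add hmd hr hz.1 hz'.1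
    _ = (∫⁻ z in A, P (closeEvent B r z.1 z.2)) ^ 2 +
          2 * ∫⁻ z in A, ∫⁻ z' in A, K z z' := by
        rw [← lintegral_lintegral_add_swap hKm, sq, ← lintegral_mul_const _ hpm,
          ← lintegral_add_left (hpm.mul_const _)]
        refine lintegral_congr fun z ↦ ?_
        rw [lintegral_add_left (hpm.const_mul _), lintegral_const_mul _ hpm]
    _ ≤ _ := by
        gcongr
        calc ∫⁻ z in A, ∫⁻ z' in A, K z z' ≤ ∫⁻ _ in A, Q ^ 2 := lintegral_mono fun z ↦ hKint z
          _ = Q ^ 2 * volume A := setLIntegral_const _ _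
          _ ≤ _ := by
            rw [mul_comm]
            gcongr
            exact volume_shortPairs_le g

theorem measure_shortPairs_le (hB : IsBrownianMotion B P)
    (hm : Measurable fun p : unitInterval × Ω ↦ B p.1 p.2) {m : ℕ} (hmd : m ≤ d)
    {r : ℝ} (hr : 0 < r) {Q : ℝ≥0∞} (hQ0 : Q ≠ 0) (hQt : Q ≠ ∞)
    (hQ : ∀ s : unitInterval, ∫⁻ t : unitInterval, hitBound m r (dist s t) ≤ Q) (g : ℝ) :
    P {ω | 2 * Q ≤ closeTime B r (shortPairs g) ω} ≤ 2 * ENNReal.ofReal g := by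
  calc P {ω | 2 * Q ≤ closeTime B r (shortPairs g) ω}
      ≤ P {ω | ∫⁻ ω, closeTime B r (shortPairs g) ω ∂P + Q ≤ closeTime B r (shortPairs g) ω} := by
        -- The mean is at most Q, so exceeding 2Q means exceeding the mean by at least Q.
        refine measure_mono fun ω hω ↦ le_trans (b := 2 * Q) ?_ hω
        rw [two_mul]
        gcongr
        exact hB.lintegral_closeTime_le hm hmd hr hQ g
    _ ≤ 2 * (ENNReal.ofReal g * Q ^ 2) / Q ^ 2 :=
        measure_lintegral_add_le_le_div_sq (measurable_closeTime hm r _) (closeTime_le_one r _)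
          hQ0 hQt (hB.lintegral_closeTime_sq_le hm hmd hr hQ g)
    _ = 2 * ENNReal.ofReal g := by
        rw [← mul_assoc, ENNReal.mul_div_cancel_right (by simpa using hQ0) (by simpa using hQt)]

theorem measure_longPairs_three_le (hB : IsBrownianMotion B P)
    (hm : Measurable fun p : unitInterval × Ω ↦ B p.1 p.2) (hd : 3 ≤ d)
    {r : ℝ} (hr : 0 < r) {c : ℝ≥0∞} (hc0 : c ≠ 0) (hct : c ≠ ∞) (g : ℝ) :
    P {ω | c ≤ closeTime B r (longPairs g) ω} ≤
      ENNReal.ofReal (r ^ 3) * ENNReal.ofReal g ^ (-(3 / 2) : ℝ) / c := by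
  refine (meas_ge_le_lintegral_div (measurable_closeTime hm r _).aemeasurable hc0 hct).trans ?_
  gcongr
  rw [lintegral_closeTime hm]
  calc ∫⁻ z in longPairs g, P (closeEvent B r z.1 z.2)
      ≤ ∫⁻ z in longPairs g, ENNReal.ofReal (r ^ 3) * ENNReal.ofReal g ^ (-(3 / 2) : ℝ) := by
        refine setLIntegral_mono' (measurableSet_longPairs g) fun z hz ↦ ?_
        refine (hB.measure_closeEvent_le_dist hd hz.1 hr).trans ((hitBound_three_le hr _).trans ?_)
        rw [ENNReal.rpow_neg, ENNReal.rpow_neg]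
        gcongr
        exact hz.2.le
    _ ≤ ENNReal.ofReal (r ^ 3) * ENNReal.ofReal g ^ (-(3 / 2) : ℝ) * 1 := by
        rw [setLIntegral_const]
        gcongr
        exact prob_le_one
    _ = _ := mul_one _

end IsBrownianMotion

end

/-! ### Long pairs by the second moment in dimension two. -/

/-- The integrable power `u ↦ u ^ (-7/8)`. -/
noncomputable def powKernel (u : ℝ) : ℝ≥0∞ := ENNReal.ofReal u ^ (-(7 / 8) : ℝ)

@[fun_prop]
theorem measurable_powKernel : Measurable powKernel := by
  unfold powKernel
  fun_prop

theorem lintegral_powKernel_dist_le (s : unitInterval) :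
    ∫⁻ t : unitInterval, powKernel (dist s t) ≤ 16 := by
  refine (lintegral_unitInterval_dist_le measurable_powKernel s).trans ?_
  calc 2 * ∫⁻ u in Ioc (0 : ℝ) 1, powKernel u ≤ 2 * ENNReal.ofReal (1 / (1 - 7 / 8)) := by
        gcongr
        exact lintegral_rpow_neg_Ioc_le (by norm_num)
    _ = 16 := by
        rw [← ENNReal.ofReal_ofNat 2, ← ENNReal.ofReal_mul (by norm_num), ← ENNReal.ofReal_ofNat 16]
        norm_num

theorem lintegral_powKernel_dist_le' (s : unitInterval) :
    ∫⁻ t : unitInterval, powKernel (dist t s) ≤ 16 := by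
  simpa only [dist_comm _ s] using lintegral_powKernel_dist_le s

/-- A kernel bounding the joint probability of two close encounters at pairs of distant times. -/
noncomputable def pairKernel (z z' : unitInterval × unitInterval) : ℝ≥0∞ :=
  powKernel (dist z.1 z.2) * powKernel (dist z'.1 z'.2) +
    (powKernel (dist z.1 z.2) * (powKernel (dist z.1 z'.1) * powKernel (dist z.2 z'.2)) +
      powKernel (dist z.1 z'.1) * (powKernel (dist z'.1 z.2) * powKernel (dist z.2 z'.2)))

theorem measurable_pairKernel : Measurable (Function.uncurry pairKernel) := by
  unfold Function.uncurry pairKernel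
  fun_prop

/-- In each of the three products the factors are the edges of a forest on the four times. Removing
leaves one at a time costs a factor 16 per edge, and there are at most three edges. -/
theorem lintegral_lintegral_pairKernel_le : ∫⁻ z, ∫⁻ z', pairKernel z z' ≤ 3 * 16 ^ 3 := by
  have hz' : ∀ z : unitInterval × unitInterval, ∫⁻ z', pairKernel z z' ≤
      powKernel (dist z.1 z.2) * 16 + (powKernel (dist z.1 z.2) * (16 * 16) +
        (∫⁻ s' : unitInterval, powKernel (dist z.1 s') * powKernel (dist s' z.2)) * 16) := by
    intro z
    have e : ∫⁻ z', pairKernel z z' = ∫⁻ s' : unitInterval, ∫⁻ t' : unitInterval,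
        pairKernel z (s', t') := by
      refine lintegral_prod (μ := volume) (ν := volume) _ ?_
      unfold pairKernel
      fun_prop
    have e1 : ∀ s' : unitInterval, ∫⁻ t' : unitInterval, pairKernel z (s', t') ≤
        powKernel (dist z.1 z.2) * (∫⁻ t' : unitInterval, powKernel (dist s' t')) +
        (powKernel (dist z.1 z.2) * (powKernel (dist z.1 s') * 16) +
          powKernel (dist z.1 s') * powKernel (dist s' z.2) * 16) := by
      intro s'
      unfold pairKernel
      simp only [← mul_assoc]
      rw [lintegral_add_left (by fun_prop), lintegral_add_left (by fun_prop),
        lintegral_const_mul _ (by fun_prop), lintegral_const_mul _ (by fun_prop),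
        lintegral_const_mul _ (by fun_prop)]
      gcongr <;> exact lintegral_powKernel_dist_le _
    rw [e]
    refine (lintegral_mono e1).trans ?_
    have hmeas : Measurable fun s' : unitInterval ↦
        ∫⁻ t' : unitInterval, powKernel (dist s' t') :=
      Measurable.lintegral_prod_right' (f := fun p : unitInterval × unitInterval ↦
        powKernel (dist p.1 p.2)) (by fun_prop)
    rw [lintegral_add_left (hmeas.const_mul _), lintegral_add_left (by fun_prop),
      lintegral_const_mul _ hmeas, lintegral_const_mul _ (by fun_prop),
      lintegral_mul_const _ (by fun_prop), lintegral_mul_const _ (by fun_prop)]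
    gcongr
    · exact (lintegral_mono fun s' ↦ lintegral_powKernel_dist_le s').trans (by simp)
    · exact lintegral_powKernel_dist_le _
  have hpow : ∫⁻ z : unitInterval × unitInterval, powKernel (dist z.1 z.2) ≤ 16 := by
    calc ∫⁻ z : unitInterval × unitInterval, powKernel (dist z.1 z.2)
        = ∫⁻ s : unitInterval, ∫⁻ t : unitInterval, powKernel (dist s t) :=
          lintegral_prod (μ := volume) (ν := volume) _ (by fun_prop)
      _ ≤ ∫⁻ _ : unitInterval, 16 := lintegral_mono lintegral_powKernel_dist_le
      _ = 16 := by simp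
  have hpath : ∫⁻ z : unitInterval × unitInterval,
      ∫⁻ s' : unitInterval, powKernel (dist z.1 s') * powKernel (dist s' z.2) ≤ 16 * 16 := by
    calc ∫⁻ z : unitInterval × unitInterval,
          ∫⁻ s' : unitInterval, powKernel (dist z.1 s') * powKernel (dist s' z.2)
        = ∫⁻ s' : unitInterval, ∫⁻ z : unitInterval × unitInterval,
            powKernel (dist z.1 s') * powKernel (dist s' z.2) :=
          lintegral_lintegral_swap (by unfold Function.uncurry; fun_prop)
      _ = ∫⁻ s' : unitInterval, (∫⁻ s : unitInterval, powKernel (dist s s')) *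
            ∫⁻ t : unitInterval, powKernel (dist s' t) :=
          lintegral_congr fun s' ↦ lintegral_prod_mul (μ := volume) (ν := volume)
            (f := fun s ↦ powKernel (dist s s')) (g := fun t ↦ powKernel (dist s' t))
            (by fun_prop) (by fun_prop)
      _ ≤ ∫⁻ _ : unitInterval, 16 * 16 := lintegral_mono fun s' ↦ by
          gcongr
          exacts [lintegral_powKernel_dist_le' _, lintegral_powKernel_dist_le _]
      _ = 16 * 16 := by simp
  refine (lintegral_mono hz').trans ?_
  rw [lintegral_add_left (by fun_prop), lintegral_add_left (by fun_prop),
    lintegral_mul_const _ (by fun_prop), lintegral_mul_const _ (by fun_prop),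
    lintegral_mul_const]
  · calc _ ≤ (16 : ℝ≥0∞) * 16 + (16 * (16 * 16) + 16 * 16 * 16) := by gcongr
      _ ≤ 3 * 16 ^ 3 := by norm_num
  · exact Measurable.lintegral_prod_right' (f := fun p : (unitInterval × unitInterval) × unitInterval
      ↦ powKernel (dist p.1.1 p.2) * powKernel (dist p.2 p.1.2)) (by fun_prop)

theorem lintegral_lintegral_mul_pairKernel_le (D : ℝ≥0∞) :
    ∫⁻ z, ∫⁻ z', D * (pairKernel z z' + pairKernel z' z) ≤ D * (6 * 16 ^ 3) := by
  have hsymm : Measurable (fun p : (unitInterval × unitInterval) × (unitInterval × unitInterval) ↦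
      pairKernel p.1 p.2 + pairKernel p.2 p.1) := by
    unfold pairKernel
    fun_prop
  have h2 : ∀ z, Measurable fun z' ↦ pairKernel z z' + pairKernel z' z := by
    unfold pairKernel
    fun_prop
  have h3 : Measurable fun z ↦ ∫⁻ z', (pairKernel z z' + pairKernel z' z) :=
    hsymm.lintegral_prod_right'
  calc ∫⁻ z, ∫⁻ z', D * (pairKernel z z' + pairKernel z' z)
      = ∫⁻ z, D * ∫⁻ z', (pairKernel z z' + pairKernel z' z) :=
        lintegral_congr fun z ↦ lintegral_const_mul _ (h2 z)
    _ = D * ∫⁻ z, ∫⁻ z', (pairKernel z z' + pairKernel z' z) := lintegral_const_mul _ h3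
    _ = D * (2 * ∫⁻ z, ∫⁻ z', pairKernel z z') := by
        rw [lintegral_lintegral_add_swap measurable_pairKernel]
    _ ≤ D * (2 * (3 * 16 ^ 3)) := by
        gcongr
        exact lintegral_lintegral_pairKernel_le
    _ = D * (6 * 16 ^ 3) := by
        rw [← mul_assoc 2]
        norm_num

/-- For nested intervals, a and c are the longer and shorter outer gaps and b is the inner length.
The excess of a⁻¹ is paid by c; that of b⁻¹ has to be paid by the cutoff, through G. -/
theorem ENNReal.mul_inv_mul_mul_inv_le {ρ a b c G : ℝ≥0∞} (hca : c ≤ a) (hc : c ≤ 1)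
    (hG : b⁻¹ ≤ b ^ (-(7 / 8) : ℝ) * G) :
    ρ * a⁻¹ * (ρ * b⁻¹) ≤ ρ ^ 2 * G *
      (a ^ (-(7 / 8) : ℝ) * b ^ (-(7 / 8) : ℝ) * c ^ (-(7 / 8) : ℝ)) := by
  have h2 : c ^ (-(1 / 8) : ℝ) ≤ c ^ (-(7 / 8) : ℝ) :=
    ENNReal.rpow_le_rpow_of_exponent_ge hc (by norm_num)
  calc ρ * a⁻¹ * (ρ * b⁻¹) ≤ ρ * (a ^ (-(7 / 8) : ℝ) * c ^ (-(7 / 8) : ℝ)) *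
        (ρ * (b ^ (-(7 / 8) : ℝ) * G)) := by
        gcongr
        exact (ENNReal.inv_le_rpow_mul_rpow hca).trans (by gcongr)
    _ = _ := by ring

/-- For interlaced intervals, b is the overlap and c the shorter outer gap. Here c absorbs the
excess of both inverses, so no cutoff factor appears. -/
theorem ENNReal.mul_inv_mul_mul_inv_add_le {ρ a b c : ℝ≥0∞} (hca : c ≤ a) (hc : c ≤ 1) :
    ρ * a⁻¹ * (ρ * (b + c)⁻¹) ≤ ρ ^ 2 *
      (a ^ (-(7 / 8) : ℝ) * b ^ (-(7 / 8) : ℝ) * c ^ (-(7 / 8) : ℝ)) := by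
  have h1 : (b + c)⁻¹ ≤ b ^ (-(7 / 8) : ℝ) * c ^ (-(1 / 8) : ℝ) := by
    refine (ENNReal.inv_le_rpow_mul_rpow (le_add_self : c ≤ b + c)).trans ?_
    gcongr ?_ * _
    rw [ENNReal.rpow_neg, ENNReal.rpow_neg]
    gcongr
    exact le_self_add
  calc ρ * a⁻¹ * (ρ * (b + c)⁻¹) ≤ ρ * (a ^ (-(7 / 8) : ℝ) * c ^ (-(1 / 8) : ℝ)) *
        (ρ * (b ^ (-(7 / 8) : ℝ) * c ^ (-(1 / 8) : ℝ))) := by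
        gcongr
        exact ENNReal.inv_le_rpow_mul_rpow hca
    _ = ρ ^ 2 * (a ^ (-(7 / 8) : ℝ) * b ^ (-(7 / 8) : ℝ) *
          (c ^ (-(1 / 8) : ℝ) * c ^ (-(1 / 8) : ℝ))) := by ring
    _ ≤ _ := by
        gcongr
        exact ENNReal.rpow_mul_self_le hc

section

variable {Ω : Type*} [MeasurableSpace Ω] {P : Measure Ω} {d : ℕ}
  {B : unitInterval → Ω → EuclideanSpace ℝ (Fin d)} [IsProbabilityMeasure P]

namespace IsBrownianMotion

/-- The joint bound for nested pairs of times `s ≤ s' ≤ t' ≤ t`. -/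
theorem measure_closeEvent_inter_le_of_nested (hB : IsBrownianMotion B P) (hd : 2 ≤ d)
    {r : ℝ} (hr : 0 < r) {s t s' t' : unitInterval} {G : ℝ≥0∞} (hs : s ≤ s') (hst' : s' ≤ t')
    (ht : t' ≤ t) (hG : (ENNReal.ofReal (dist s' t'))⁻¹ ≤ powKernel (dist s' t') * G) :
    P (closeEvent B r s t ∩ closeEvent B r s' t') ≤ ENNReal.ofReal (r ^ 2) ^ 2 * G *
      (powKernel (dist s' t') * (powKernel (dist s' s) * powKernel (dist t' t))) := by
  have hle : ∀ x y : unitInterval, ENNReal.ofReal (dist x y) ≤ 1 := fun x y ↦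
    ENNReal.ofReal_le_one.2 (unitInterval.dist_le_one x y)
  have hb : P (closeEvent B r s' t') ≤
      ENNReal.ofReal (r ^ 2) * (ENNReal.ofReal (dist s' t'))⁻¹ :=
    (hB.measure_closeEvent_le_dist hd hst' hr).trans (hitBound_two_le _ _)
  -- The longer outer gap is the one detached, so that the shorter is available to absorb the excess
  -- of its inverse.
  rcases le_total (dist t' t) (dist s' s) with h | h
  · have h1 := hB.measure_closeEvent_inter_le_left hd hr hs (hst'.trans ht) hst'
    rw [← unitInterval.dist_eq_sub hs, dist_comm s s'] at h1
    refine h1.trans ((mul_le_mul' (hitBound_two_le _ _) hb).trans ?_)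
    refine (ENNReal.mul_inv_mul_mul_inv_le (ENNReal.ofReal_le_ofReal h) (hle _ _) hG).trans
      (le_of_eq ?_)
    unfold powKernel
    ring
  · have h1 := hB.measure_closeEvent_inter_le_right hd hr hst' (hs.trans hst') ht
    rw [← unitInterval.dist_eq_sub ht, inter_comm] at h1
    refine h1.trans ((mul_le_mul' (hitBound_two_le _ _) hb).trans ?_)
    refine (ENNReal.mul_inv_mul_mul_inv_le (ENNReal.ofReal_le_ofReal h) (hle _ _) hG).trans
      (le_of_eq ?_)
    unfold powKernel
    ring

/-- The joint bound for interlaced pairs of times `s ≤ s' ≤ t ≤ t'`. -/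
theorem measure_closeEvent_inter_le_of_interlaced (hB : IsBrownianMotion B P) (hd : 2 ≤ d)
    {r : ℝ} (hr : 0 < r) {s t s' t' : unitInterval} (hs : s ≤ s') (hst : s' ≤ t) (ht : t ≤ t') :
    P (closeEvent B r s t ∩ closeEvent B r s' t') ≤ ENNReal.ofReal (r ^ 2) ^ 2 *
      (powKernel (dist s s') * (powKernel (dist s' t) * powKernel (dist t t'))) := by
  have hle : ∀ x y : unitInterval, ENNReal.ofReal (dist x y) ≤ 1 := fun x y ↦
    ENNReal.ofReal_le_one.2 (unitInterval.dist_le_one x y)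
  have hadd : ∀ {x y z : unitInterval}, x ≤ y → y ≤ z → ENNReal.ofReal (dist x z) =
      ENNReal.ofReal (dist x y) + ENNReal.ofReal (dist y z) := by
    intro x y z hxy hyz
    rw [← ENNReal.ofReal_add dist_nonneg dist_nonneg, unitInterval.dist_eq_sub hxy,
      unitInterval.dist_eq_sub hyz, unitInterval.dist_eq_sub (hxy.trans hyz)]
    congr 1
    ring
  -- Once the longer outer gap is detached, the remaining interval consists of the overlap and the
  -- shorter outer gap.
  rcases le_total (dist t t') (dist s s') with h | h
  · have h1 := hB.measure_closeEvent_inter_le_left hd hr hs hst (hst.trans ht)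
    have hb := (hB.measure_closeEvent_le_dist hd (hst.trans ht) hr).trans (hitBound_two_le _ _)
    rw [← unitInterval.dist_eq_sub hs] at h1
    rw [hadd hst ht] at hb
    refine h1.trans ((mul_le_mul' (hitBound_two_le _ _) hb).trans ?_)
    refine (ENNReal.mul_inv_mul_mul_inv_add_le (ENNReal.ofReal_le_ofReal h) (hle _ _)).trans
      (le_of_eq ?_)
    unfold powKernel
    ring
  · have h1 := hB.measure_closeEvent_inter_le_right hd hr (hs.trans hst) hst ht
    have hb := (hB.measure_closeEvent_le_dist hd (hs.trans hst) hr).trans (hitBound_two_le _ _)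
    rw [← unitInterval.dist_eq_sub ht] at h1
    rw [hadd hs hst, add_comm] at hb
    refine h1.trans ((mul_le_mul' (hitBound_two_le _ _) hb).trans ?_)
    refine (ENNReal.mul_inv_mul_mul_inv_add_le (ENNReal.ofReal_le_ofReal h) (hle _ _)).trans
      (le_of_eq ?_)
    unfold powKernel
    ring

theorem measure_closeEvent_inter_le_pairKernel (hB : IsBrownianMotion B P) (hd : 2 ≤ d)
    {r : ℝ} (hr : 0 < r) {g : ℝ} (hg : g ≤ 1) {z z' : unitInterval × unitInterval}
    (hz : z ∈ longPairs g) (hz' : z' ∈ longPairs g) :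
    P (closeEvent B r z.1 z.2 ∩ closeEvent B r z'.1 z'.2) ≤
      ENNReal.ofReal (r ^ 2) ^ 2 * (ENNReal.ofReal g ^ (-(1 / 8) : ℝ)) ^ 2 *
        (pairKernel z z' + pairKernel z' z) := by
  wlog hss : z.1 ≤ z'.1 generalizing z z'
  · rw [inter_comm, add_comm]
    exact this hz' hz (le_of_not_ge hss)
  set G := ENNReal.ofReal g ^ (-(1 / 8) : ℝ) with hGdef
  set ρ := ENNReal.ofReal (r ^ 2) with hρ
  have hG1 : 1 ≤ G := by
    rw [hGdef, ENNReal.rpow_neg, ENNReal.one_le_inv]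
    exact ENNReal.rpow_le_one (ENNReal.ofReal_le_one.2 hg) (by norm_num)
  have hG : ∀ {w : unitInterval × unitInterval}, w ∈ longPairs g →
      (ENNReal.ofReal (dist w.1 w.2))⁻¹ ≤ powKernel (dist w.1 w.2) * G := fun hw ↦
    ENNReal.inv_le_rpow_mul_rpow (ENNReal.ofReal_le_ofReal hw.2.le)
  have hP : ∀ {w : unitInterval × unitInterval}, w ∈ longPairs g →
      P (closeEvent B r w.1 w.2) ≤ ρ * (powKernel (dist w.1 w.2) * G) := fun {w} hw ↦ by
    refine (hB.measure_closeEvent_le_dist hd hw.1 hr).trans ((hitBound_two_le _ _).trans ?_)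
    gcongr
    exact hG hw
  rcases le_total z.2 z'.1 with h | h
  · rw [hB.measure_closeEvent_inter_eq hz.1 h hz'.1]
    calc _ ≤ ρ * (powKernel (dist z.1 z.2) * G) * (ρ * (powKernel (dist z'.1 z'.2) * G)) :=
          mul_le_mul' (hP hz) (hP hz')
      _ = ρ ^ 2 * G ^ 2 * (powKernel (dist z.1 z.2) * powKernel (dist z'.1 z'.2)) := by ring
      _ ≤ _ := by
          gcongr
          exact le_self_add.trans le_self_add
  rcases le_total z'.2 z.2 with h' | h'
  · refine (hB.measure_closeEvent_inter_le_of_nested hd hr hss hz'.1 h' (hG hz')).trans ?_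
    gcongr
    · exact le_self_pow hG1 two_ne_zero
    · exact (le_self_add.trans le_add_self).trans le_add_self
  · refine (hB.measure_closeEvent_inter_le_of_interlaced hd hr hss h h').trans ?_
    gcongr
    · exact le_mul_of_one_le_right' (one_le_pow₀ hG1)
    · exact (le_add_self.trans le_add_self).trans le_self_add

theorem measure_longPairs_two_le (hB : IsBrownianMotion B P)
    (hm : Measurable fun p : unitInterval × Ω ↦ B p.1 p.2) (hd : 2 ≤ d)
    {r : ℝ} (hr : 0 < r) {c : ℝ≥0∞} (hc0 : c ≠ 0) (hct : c ≠ ∞) {g : ℝ} (hg : g ≤ 1) :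
    P {ω | c ≤ closeTime B r (longPairs g) ω} ≤
      ENNReal.ofReal (r ^ 2) ^ 2 * (ENNReal.ofReal g ^ (-(1 / 8) : ℝ)) ^ 2 * (6 * 16 ^ 3) /
        c ^ 2 := by
  have hAm := measurableSet_longPairs g
  set A := longPairs g with hA
  set D := ENNReal.ofReal (r ^ 2) ^ 2 * (ENNReal.ofReal g ^ (-(1 / 8) : ℝ)) ^ 2 with hD
  calc P {ω | c ≤ closeTime B r A ω} ≤ P {ω | c ^ 2 ≤ closeTime B r A ω ^ 2} :=
        measure_mono fun ω hω ↦ by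
          rw [mem_ofPred_eq] at hω ⊢
          gcongr
    _ ≤ (∫⁻ ω, closeTime B r A ω ^ 2 ∂P) / c ^ 2 :=
        meas_ge_le_lintegral_div ((measurable_closeTime hm r _).pow_const 2).aemeasurable
          (by simpa using hc0) (by simpa using hct)
    _ ≤ _ := by
        gcongr
        rw [lintegral_closeTime_sq hm]
        calc ∫⁻ z in A, ∫⁻ z' in A, P (closeEvent B r z.1 z.2 ∩ closeEvent B r z'.1 z'.2)
            ≤ ∫⁻ z in A, ∫⁻ z' in A, D * (pairKernel z z' + pairKernel z' z) :=
              setLIntegral_mono' hAm fun z hz ↦ setLIntegral_mono' hAm fun z' hz' ↦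
                hB.measure_closeEvent_inter_le_pairKernel hd hr hg hz hz'
          _ ≤ ∫⁻ z, ∫⁻ z', D * (pairKernel z z' + pairKernel z' z) :=
              (setLIntegral_le_lintegral _ _).trans
                (lintegral_mono fun z ↦ setLIntegral_le_lintegral _ _)
          _ ≤ D * (6 * 16 ^ 3) := lintegral_lintegral_mul_pairKernel_le D

end IsBrownianMotion

end

/-! ### Deterministic dyadic estimate of the energy. -/

/-- The mass that a weight gives to the dyadic shell `(2⁻⁽ⁿ⁺¹⁾, 2⁻ⁿ]`. -/
noncomputable def shellMass (W : ℝ → ℝ≥0∞) (n : ℕ) : ℝ≥0∞ :=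
  ∫⁻ u in Ioc ((1 / 2 : ℝ) ^ (n + 1)) ((1 / 2 : ℝ) ^ n), W u

theorem half_pow_antitone : Antitone fun n : ℕ ↦ (1 / 2 : ℝ) ^ n :=
  fun _ _ h ↦ pow_le_pow_of_le_one (by norm_num) (by norm_num) h

theorem shellMass_le {W : ℝ → ℝ≥0∞} (hW1 : ∀ u ∈ Ioc (0 : ℝ) 1, W u ≤ 1) (n : ℕ) :
    shellMass W n ≤ ENNReal.ofReal ((1 / 2) ^ n) := by
  calc shellMass W n ≤ ∫⁻ u in Ioc ((1 / 2 : ℝ) ^ (n + 1)) ((1 / 2 : ℝ) ^ n), 1 := by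
        refine setLIntegral_mono' measurableSet_Ioc fun u hu ↦ hW1 u ⟨?_, ?_⟩
        · exact lt_trans (by positivity) hu.1
        · exact hu.2.trans (pow_le_one₀ (by norm_num) (by norm_num))
    _ ≤ ENNReal.ofReal ((1 / 2) ^ n) := by
        rw [setLIntegral_one, Real.volume_Ioc]
        refine ENNReal.ofReal_le_ofReal (sub_le_self _ (by positivity))

theorem tsum_shellMass_mul_le (W : ℝ → ℝ≥0∞) {f : ℝ≥0 → ℝ≥0∞} (hf : Antitone f) :
    ∑' n, f ((1 / 2) ^ n) * shellMass W n ≤ ∫⁻ u in Ioc (0 : ℝ) 1, W u * f u.toNNReal := by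
  have hfm : Measurable fun u : ℝ ↦ f u.toNNReal := hf.measurable.comp measurable_real_toNNReal
  set I : ℕ → Set ℝ := fun n ↦ Ioc ((1 / 2 : ℝ) ^ (n + 1)) ((1 / 2 : ℝ) ^ n) with hI
  have hdisj : Pairwise (Function.onFun Disjoint I) := half_pow_antitone.pairwise_disjoint_on_Ioc_succ
  have hsub : ⋃ n, I n ⊆ Ioc (0 : ℝ) 1 := by
    refine iUnion_subset fun n u hu ↦ ⟨lt_trans (by positivity) hu.1, hu.2.trans ?_⟩
    exact pow_le_one₀ (by norm_num) (by norm_num)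
  calc ∑' n, f ((1 / 2) ^ n) * shellMass W n ≤ ∑' n, ∫⁻ u in I n, W u * f u.toNNReal := by
        refine ENNReal.tsum_le_tsum fun n ↦ ?_
        refine (lintegral_const_mul_le _ _).trans ?_
        refine setLIntegral_mono' measurableSet_Ioc fun u hu ↦ ?_
        rw [mul_comm]
        gcongr
        refine hf (Real.toNNReal_le_iff_le_coe.2 ?_)
        simpa using hu.2
    _ = ∫⁻ u in ⋃ n, I n, W u * f u.toNNReal :=
        (lintegral_iUnion (fun n ↦ measurableSet_Ioc) hdisj _).symm
    _ ≤ _ := lintegral_mono_set hsub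

/-- The amount of pairs of times at which a path takes values at distance at most `r`. -/
noncomputable def selfCloseTime {E : Type*} [NormedAddCommGroup E] (w : unitInterval → E) (r : ℝ) :
    ℝ≥0∞ :=
  volume {z : unitInterval × unitInterval | ‖w z.2 - w z.1‖ ≤ r}

theorem selfCloseTime_le_one {E : Type*} [NormedAddCommGroup E] (w : unitInterval → E) (r : ℝ) :
    selfCloseTime w r ≤ 1 :=
  prob_le_one

theorem energy_occupationMeasure_eq {d : ℕ} {w : unitInterval → EuclideanSpace ℝ (Fin d)}
    (hw : Measurable w) {f : ℝ≥0 → ℝ≥0∞} (hf : Measurable f) :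
    energy f (occupationMeasure w) =
      ∫⁻ z : unitInterval × unitInterval, f (nndist (w z.2) (w z.1)) := by
  have h1 : Measurable fun p : EuclideanSpace ℝ (Fin d) × EuclideanSpace ℝ (Fin d) ↦
      f (nndist p.2 p.1) := by fun_prop
  unfold energy occupationMeasure
  rw [lintegral_map h1.lintegral_prod_right' hw]
  refine Eq.trans (lintegral_congr fun s ↦ ?_)
    (lintegral_prod (μ := volume) (ν := volume) _ (by fun_prop)).symm
  exact lintegral_map (h1.comp measurable_prodMk_left) hw

/-- A distance in (2⁻⁽ⁿ⁺¹⁾, 2⁻ⁿ] has f at most f(2⁻⁽ⁿ⁺¹⁾), and this value is a lower bound for f on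
the next shell. Hence the shift to index n + 1 in the hypothesis. -/
theorem energy_le_of_selfCloseTime_le {d : ℕ} {w : unitInterval → EuclideanSpace ℝ (Fin d)}
    (hw : Measurable w) {W : ℝ → ℝ≥0∞} (hW1 : ∀ u ∈ Ioc (0 : ℝ) 1, W u ≤ 1)
    (hW0 : shellMass W 0 ≠ 0) {K : ℝ≥0∞} (hK : K ≠ ∞)
    (h : ∀ n : ℕ, selfCloseTime w ((1 / 2) ^ n) ≤ K * shellMass W (n + 1))
    {f : ℝ≥0 → ℝ≥0∞} (hf : Antitone f) :
    energy f (occupationMeasure w) ≤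
      (K + (shellMass W 0)⁻¹) * ∫⁻ u in Ioc (0 : ℝ) 1, W u * f u.toNNReal := by
  set A : ℕ → Set (unitInterval × unitInterval) :=
    fun n ↦ {z | ‖w z.2 - w z.1‖ ≤ (1 / 2 : ℝ) ^ n} with hA
  have hAm : ∀ n, MeasurableSet (A n) := fun n ↦
    measurableSet_le (by fun_prop) measurable_const
  -- Coincidence times, where f(0) may be infinite, form a null set because the hypothesis forces
  -- their measure below every K · 2⁻ⁿ.
  have hnull : ∀ᵐ z : unitInterval × unitInterval, nndist (w z.2) (w z.1) ≠ 0 := by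
    have hle : ∀ n : ℕ, volume {z : unitInterval × unitInterval | ¬ nndist (w z.2) (w z.1) ≠ 0} ≤
        K * ENNReal.ofReal ((1 / 2) ^ n) := by
      intro n
      refine le_trans (measure_mono fun z hz ↦ ?_) ((h n).trans ?_)
      · have hz' : w z.2 = w z.1 := by simpa using hz
        simp [hz']
      · gcongr
        refine (shellMass_le hW1 (n + 1)).trans (ENNReal.ofReal_le_ofReal ?_)
        exact half_pow_antitone n.le_succ
    have hlim : Tendsto (fun n : ℕ ↦ K * ENNReal.ofReal ((1 / 2) ^ n)) atTop (𝓝 0) := by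
      have h1 : Tendsto (fun n : ℕ ↦ ENNReal.ofReal ((1 / 2) ^ n)) atTop (𝓝 0) := by
        rw [← ENNReal.ofReal_zero]
        exact ENNReal.tendsto_ofReal
          (tendsto_pow_atTop_nhds_zero_of_lt_one (by norm_num) (by norm_num))
      simpa using ENNReal.Tendsto.const_mul h1 (Or.inr hK)
    exact le_zero_iff.1 (ge_of_tendsto' hlim hle)
  have hpt : ∀ z : unitInterval × unitInterval, nndist (w z.2) (w z.1) ≠ 0 →
      f (nndist (w z.2) (w z.1)) ≤
        f 1 + ∑' n, (A n).indicator (fun _ ↦ f ((1 / 2) ^ (n + 1))) z := by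
    intro z hz
    rcases le_or_gt (nndist (w z.2) (w z.1)) 1 with h1 | h1
    · obtain ⟨n, hn1, hn2⟩ := exists_nat_pow_near_of_lt_one (pos_iff_ne_zero.2 hz) h1
        (by norm_num : (0 : ℝ≥0) < 1 / 2) (by norm_num)
      refine le_trans ?_ ((ENNReal.le_tsum n).trans le_add_self)
      rw [indicator_of_mem]
      · exact hf hn1.le
      · have : (nndist (w z.2) (w z.1) : ℝ) ≤ ((1 / 2 : ℝ≥0) ^ n : ℝ≥0) := by exact_mod_cast hn2
        simpa [hA, dist_eq_norm] using this
    · exact (hf h1.le).trans le_self_add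
  have hS := tsum_shellMass_mul_le W hf
  set J := ∫⁻ u in Ioc (0 : ℝ) 1, W u * f u.toNNReal with hJ
  -- Distances above 1 contribute at most f(1), which is controlled by the first shell, the one left
  -- free by the index shift.
  have h0 : f 1 ≤ (shellMass W 0)⁻¹ * J := by
    have h0t : shellMass W 0 ≠ ∞ := ((shellMass_le hW1 0).trans_lt ENNReal.ofReal_lt_top).ne
    rw [mul_comm, ← div_eq_mul_inv, ENNReal.le_div_iff_mul_le (Or.inl hW0) (Or.inl h0t)]
    refine le_trans ?_ ((ENNReal.le_tsum 0).trans hS)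
    simp
  calc energy f (occupationMeasure w)
      = ∫⁻ z : unitInterval × unitInterval, f (nndist (w z.2) (w z.1)) :=
        energy_occupationMeasure_eq hw hf.measurable
    _ ≤ ∫⁻ z : unitInterval × unitInterval,
          (f 1 + ∑' n, (A n).indicator (fun _ ↦ f ((1 / 2) ^ (n + 1))) z) :=
        lintegral_mono_ae (hnull.mono hpt)
    _ = f 1 + ∑' n, f ((1 / 2) ^ (n + 1)) * volume (A n) := by
        rw [lintegral_add_left measurable_const,
          lintegral_tsum fun n ↦ (measurable_const.indicator (hAm n)).aemeasurable]
        simp [lintegral_indicator_const (hAm _)]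
    _ ≤ (shellMass W 0)⁻¹ * J + ∑' n, K * (f ((1 / 2) ^ (n + 1)) * shellMass W (n + 1)) := by
        refine add_le_add h0 (ENNReal.tsum_le_tsum fun n ↦ ?_)
        rw [mul_left_comm]
        gcongr
        exact h n
    _ ≤ (shellMass W 0)⁻¹ * J + K * J := by
        rw [ENNReal.tsum_mul_left]
        gcongr
        exact (ENNReal.tsum_comp_le_tsum_of_injective (add_left_injective 1)
          fun n ↦ f ((1 / 2) ^ n) * shellMass W n).trans hS
    _ = _ := by rw [add_mul, add_comm]

/-- The finitely many exceptional terms are at most 1, so adding the inverses of the corresponding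
`v i` to the constant covers them. -/
theorem exists_forall_le_mul_of_eventually {F v : ℕ → ℝ≥0∞} {a : ℝ≥0∞} (ha : a ≠ ∞)
    (hF : ∀ n, F n ≤ 1) (hv0 : ∀ n, v n ≠ 0) (hvt : ∀ n, v n ≠ ∞)
    (h : ∀ᶠ n in atTop, F n ≤ a * v n) : ∃ K : ℝ≥0∞, K ≠ ∞ ∧ ∀ n, F n ≤ K * v n := by
  obtain ⟨N, hN⟩ := eventually_atTop.1 h
  refine ⟨a + ∑ i ∈ Finset.range N, (v i)⁻¹, ?_, fun n ↦ ?_⟩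
  · exact ENNReal.add_ne_top.2 ⟨ha, ENNReal.sum_ne_top.2 fun i _ ↦ ENNReal.inv_ne_top.2 (hv0 i)⟩
  · rcases le_or_gt N n with hn | hn
    · refine (hN n hn).trans ?_
      gcongr
      exact le_self_add
    · calc F n ≤ (v n)⁻¹ * v n := by rw [ENNReal.inv_mul_cancel (hv0 n) (hvt n)]; exact hF n
        _ ≤ _ := by
          gcongr
          refine le_trans ?_ le_add_self
          exact Finset.single_le_sum (f := fun i ↦ (v i)⁻¹) (fun _ _ ↦ zero_le)
            (Finset.mem_range.2 hn)

theorem le_shellMass {W : ℝ → ℝ≥0∞} {n : ℕ} {c : ℝ} (hc : 0 ≤ c)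
    (h : ∀ u ∈ Ioc ((1 / 2 : ℝ) ^ (n + 1)) ((1 / 2 : ℝ) ^ n), ENNReal.ofReal c ≤ W u) :
    ENNReal.ofReal (c * (1 / 2) ^ (n + 1)) ≤ shellMass W n := by
  calc ENNReal.ofReal (c * (1 / 2) ^ (n + 1))
      = ∫⁻ u in Ioc ((1 / 2 : ℝ) ^ (n + 1)) ((1 / 2 : ℝ) ^ n), ENNReal.ofReal c := by
        rw [setLIntegral_const, Real.volume_Ioc, ← ENNReal.ofReal_mul hc]
        congr 2
        ring
    _ ≤ _ := setLIntegral_mono' measurableSet_Ioc h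

theorem selfCloseTime_le {Ω : Type*} {d : ℕ} (B : unitInterval → Ω → EuclideanSpace ℝ (Fin d))
    (r g : ℝ) (ω : Ω) :
    selfCloseTime (fun t ↦ B t ω) r ≤
      2 * (closeTime B r (shortPairs g) ω + closeTime B r (longPairs g) ω) := by
  set S := {z : unitInterval × unitInterval | ω ∈ closeEvent B r z.1 z.2} with hS
  set A := (S ∩ shortPairs g) ∪ (S ∩ longPairs g) with hA
  have hmem : ∀ z ∈ S, z.1 ≤ z.2 → z ∈ A := fun z hz hle ↦ by
    rcases le_or_gt (dist z.1 z.2) g with h | h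
    · exact Or.inl ⟨hz, hle, h⟩
    · exact Or.inr ⟨hz, hle, h⟩
  have hcover : S ⊆ A ∪ Prod.swap ⁻¹' A := by
    intro z hz
    rcases le_total z.1 z.2 with h | h
    · exact Or.inl (hmem z hz h)
    · refine Or.inr (hmem z.swap ?_ h)
      simpa [hS, closeEvent, norm_sub_rev] using hz
  have hswap : volume (Prod.swap ⁻¹' A) = volume A :=
    (Measure.measurePreserving_swap (μ := (volume : Measure unitInterval))
      (ν := (volume : Measure unitInterval))).measure_preimage_equiv
        (f := MeasurableEquiv.prodComm) A
  calc selfCloseTime (fun t ↦ B t ω) r = volume S := rfl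
    _ ≤ volume A + volume A :=
        (measure_mono hcover).trans ((measure_union_le _ _).trans_eq (by rw [hswap]))
    _ = 2 * volume A := (two_mul _).symm
    _ ≤ 2 * (volume (S ∩ shortPairs g) + volume (S ∩ longPairs g)) := by
        gcongr
        exact measure_union_le _ _
    _ = _ := by
        rw [closeTime, closeTime, Measure.restrict_apply' (measurableSet_shortPairs g),
          Measure.restrict_apply' (measurableSet_longPairs g)]

/-! ### Borel–Cantelli along dyadic radii, and conclusion. -/

theorem tsum_two_mul_ofReal_inv_sq_ne_top :
    ∑' n : ℕ, 2 * ENNReal.ofReal (((n + 1 : ℝ) ^ 2)⁻¹) ≠ ∞ := by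
  have h : Summable fun n : ℕ ↦ ((n + 1 : ℝ) ^ 2)⁻¹ := by
    have := (summable_nat_add_iff 1).2 (Real.summable_nat_pow_inv.2 (by norm_num : 1 < 2))
    simpa using this
  rw [ENNReal.tsum_mul_left]
  exact ENNReal.mul_ne_top (by norm_num) h.tsum_ofReal_ne_top

section

variable {Ω : Type*} [MeasurableSpace Ω] {P : Measure Ω} [IsProbabilityMeasure P] {d : ℕ}
  {B : unitInterval → Ω → EuclideanSpace ℝ (Fin d)}

namespace IsBrownianMotion

theorem ae_exists_energy_le (hB : IsBrownianMotion B P)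
    (hm : Measurable fun p : unitInterval × Ω ↦ B p.1 p.2) {m : ℕ} (hmd : m ≤ d)
    {W : ℝ → ℝ≥0∞} (hW1 : ∀ u ∈ Ioc (0 : ℝ) 1, W u ≤ 1) (hW0 : ∀ n, shellMass W n ≠ 0)
    {Q : ℕ → ℝ≥0∞} (hQ0 : ∀ n, Q n ≠ 0) (hQt : ∀ n, Q n ≠ ∞)
    (hQ : ∀ n, ∀ s : unitInterval,
      ∫⁻ t : unitInterval, hitBound m ((1 / 2) ^ n) (dist s t) ≤ Q n)
    {a : ℝ≥0∞} (ha : a ≠ ∞) (hQW : ∀ n, Q n ≤ a * shellMass W (n + 1))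
    (hlong : ∑' n : ℕ, P {ω | Q n ≤
      closeTime B ((1 / 2) ^ n) (longPairs ((n + 1 : ℝ) ^ 2)⁻¹) ω} ≠ ∞) :
    ∀ᵐ ω ∂P, ∃ C : ℝ≥0, ∀ f : ℝ≥0 → ℝ≥0∞, IsKernelFunction f →
      energy f (occupationMeasure fun t ↦ B t ω) ≤
        C * ∫⁻ r in Ioc (0 : ℝ) 1, W r * f r.toNNReal := by
  have hshort : ∑' n : ℕ, P {ω | 2 * Q n ≤
      closeTime B ((1 / 2) ^ n) (shortPairs ((n + 1 : ℝ) ^ 2)⁻¹) ω} ≠ ∞ := by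
    refine ne_top_of_le_ne_top tsum_two_mul_ofReal_inv_sq_ne_top
      (ENNReal.tsum_le_tsum fun n ↦ ?_)
    exact hB.measure_shortPairs_le hm hmd (by positivity) (hQ0 n) (hQt n) (hQ n) _
  -- Borel–Cantelli: from some n on, short pairs contribute less than 2 Qₙ and long pairs less than
  -- Qₙ. Doubling for the order of the two times gives the factor 6 below.
  filter_upwards [ae_eventually_notMem hlong, ae_eventually_notMem hshort] with ω h1 h2
  have hev : ∀ᶠ n : ℕ in atTop, selfCloseTime (fun t ↦ B t ω) ((1 / 2) ^ n) ≤
      6 * a * shellMass W (n + 1) := by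
    filter_upwards [h1, h2] with n hn1 hn2
    rw [not_le] at hn1 hn2
    calc selfCloseTime (fun t ↦ B t ω) ((1 / 2) ^ n) ≤ 2 * (2 * Q n + Q n) := by
          refine (selfCloseTime_le B _ (((n + 1 : ℝ) ^ 2)⁻¹) ω).trans ?_
          gcongr
      _ = 6 * Q n := by ring
      _ ≤ 6 * (a * shellMass W (n + 1)) := by
          gcongr
          exact hQW n
      _ = _ := (mul_assoc _ _ _).symm
  obtain ⟨K, hK, hKn⟩ := exists_forall_le_mul_of_eventually (v := fun n ↦ shellMass W (n + 1))
    (ENNReal.mul_ne_top (by norm_num) ha) (fun n ↦ selfCloseTime_le_one _ _) (fun n ↦ hW0 _)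
    (fun n ↦ ((shellMass_le hW1 _).trans_lt ENNReal.ofReal_lt_top).ne) hev
  have hC : K + (shellMass W 0)⁻¹ ≠ ∞ :=
    ENNReal.add_ne_top.2 ⟨hK, ENNReal.inv_ne_top.2 (hW0 0)⟩
  refine ⟨(K + (shellMass W 0)⁻¹).toNNReal, fun f hf ↦ ?_⟩
  rw [ENNReal.coe_toNNReal hC]
  exact energy_le_of_selfCloseTime_le (hm.comp measurable_prodMk_right) hW1 (hW0 0) hK hKn
    hf.antitone

theorem ae_exists_energy_le_of_three_le (hB : IsBrownianMotion B P)
    (hm : Measurable fun p : unitInterval × Ω ↦ B p.1 p.2) (hd : 3 ≤ d) :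
    ∀ᵐ ω ∂P, ∃ C : ℝ≥0, ∀ f : ℝ≥0 → ℝ≥0∞, IsKernelFunction f →
      energy f (occupationMeasure fun t ↦ B t ω) ≤
        C * ∫⁻ r in Ioc (0 : ℝ) 1, ENNReal.ofReal r * f r.toNNReal := by
  have hshell : ∀ n : ℕ, ENNReal.ofReal ((1 / 2) ^ (n + 1) * (1 / 2) ^ (n + 1)) ≤
      shellMass ENNReal.ofReal n := fun n ↦
    le_shellMass (by positivity) fun u hu ↦ ENNReal.ofReal_le_ofReal hu.1.le
  have hQpos : ∀ n : ℕ, 0 < 6 * ((1 / 2 : ℝ) ^ n) ^ 2 := fun n ↦ by positivity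
  -- Q is twice the bound 3r² at r = 2⁻ⁿ, one for each side of s. The shell of index n + 1 has mass
  -- at least 4⁻⁽ⁿ⁺²⁾, whence 96 = 6 · 16.
  refine hB.ae_exists_energy_le hm hd (W := ENNReal.ofReal)
    (Q := fun n ↦ ENNReal.ofReal (6 * ((1 / 2) ^ n) ^ 2)) (a := ENNReal.ofReal 96)
    (fun u hu ↦ ENNReal.ofReal_le_one.2 hu.2) (fun n ↦ ?_) (fun n ↦ ?_)
    (fun n ↦ ENNReal.ofReal_ne_top) (fun n s ↦ ?_) ENNReal.ofReal_ne_top (fun n ↦ ?_) ?_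
  · exact ((ENNReal.ofReal_pos.2 (by positivity)).trans_le (hshell n)).ne'
  · exact (ENNReal.ofReal_pos.2 (hQpos n)).ne'
  · refine (lintegral_unitInterval_dist_le (measurable_hitBound 3 _) s).trans ?_
    calc 2 * ∫⁻ u in Ioc (0 : ℝ) 1, hitBound 3 ((1 / 2) ^ n) u
        ≤ ENNReal.ofReal 2 * ENNReal.ofReal (3 * ((1 / 2) ^ n) ^ 2) := by
          rw [ENNReal.ofReal_ofNat]
          gcongr
          exact lintegral_hitBound_three_le (by positivity)
            (pow_le_one₀ (by norm_num) (by norm_num))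
      _ = _ := by
          rw [← ENNReal.ofReal_mul (by norm_num), ← mul_assoc]
          norm_num
  · refine le_trans (le_of_eq ?_) (mul_le_mul' le_rfl (hshell (n + 1)))
    rw [← ENNReal.ofReal_mul (by norm_num)]
    congr 1
    ring
  -- With g = (n+1)⁻² the first-moment tail is r³ (n+1)³ / (6 r²), which is geometrically small.
  · have hsum : Summable fun n : ℕ ↦ (1 / 3 : ℝ) * (((n + 1 : ℕ) : ℝ) ^ 3 * (1 / 2) ^ (n + 1)) :=
      ((summable_nat_add_iff 1).2 (summable_pow_mul_geometric_of_norm_lt_one (R := ℝ) 3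
        (r := 1 / 2) (by norm_num))).mul_left _
    refine ne_top_of_le_ne_top hsum.tsum_ofReal_ne_top (ENNReal.tsum_le_tsum fun n ↦ ?_)
    refine (hB.measure_longPairs_three_le hm hd (by positivity)
      (ENNReal.ofReal_pos.2 (hQpos n)).ne' ENNReal.ofReal_ne_top _).trans (le_of_eq ?_)
    have hn : (0 : ℝ) < n + 1 := by positivity
    rw [ENNReal.ofReal_rpow_of_pos (by positivity), ← ENNReal.ofReal_mul (by positivity),
      ← ENNReal.ofReal_div_of_pos (hQpos n)]
    congr 1
    have : (((n + 1 : ℝ) ^ 2)⁻¹) ^ (-(3 / 2) : ℝ) = (n + 1) ^ 3 := by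
      rw [Real.inv_rpow (by positivity), Real.rpow_neg (by positivity), inv_inv,
        ← Real.rpow_natCast _ 2, ← Real.rpow_mul hn.le]
      norm_num
    rw [this]
    push_cast
    field_simp
    ring

theorem ae_exists_energy_le_of_two_le (hB : IsBrownianMotion B P)
    (hm : Measurable fun p : unitInterval × Ω ↦ B p.1 p.2) (hd : 2 ≤ d) :
    ∀ᵐ ω ∂P, ∃ C : ℝ≥0, ∀ f : ℝ≥0 → ℝ≥0∞, IsKernelFunction f →
      energy f (occupationMeasure fun t ↦ B t ω) ≤
        C * ∫⁻ r in Ioc (0 : ℝ) 1, ENNReal.ofReal (r * Real.log (1 / r)) * f r.toNNReal := by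
  have hlog2 : 1 / 2 < Real.log 2 := lt_trans (by norm_num) Real.log_two_gt_d9
  have hlog2' : Real.log 2 < 1 := lt_trans Real.log_two_lt_d9 (by norm_num)
  set W : ℝ → ℝ≥0∞ := fun r ↦ ENNReal.ofReal (r * Real.log (1 / r)) with hW
  have hlogpow : ∀ n : ℕ, Real.log (1 / (1 / 2) ^ n) = n * Real.log 2 := fun n ↦ by
    rw [one_div_pow, one_div_one_div, Real.log_pow]
  have hshell : ∀ n : ℕ,
      ENNReal.ofReal ((1 / 2) ^ (n + 1) * (n * Real.log 2) * (1 / 2) ^ (n + 1)) ≤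
        shellMass W n := fun n ↦ by
    refine le_shellMass (by positivity) fun u hu ↦ ENNReal.ofReal_le_ofReal ?_
    have hu0 : 0 < u := lt_trans (by positivity) hu.1
    rw [← hlogpow]
    gcongr
    · exact Real.log_nonneg (one_le_one_div (by positivity)
        (pow_le_one₀ (by norm_num) (by norm_num)))
    · exact hu.1.le
    · exact hu.2
  -- The general lower bound vanishes for n = 0 because log(1/u) vanishes at u = 1, so the first
  -- shell is restricted to (1/2, 3/4].
  have hshell0 : shellMass W 0 ≠ 0 := by
    have hlog : 0 < Real.log (4 / 3) := Real.log_pos (by norm_num)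
    have hpos : 0 < ENNReal.ofReal (1 / 2 * Real.log (4 / 3)) * ENNReal.ofReal (1 / 4) :=
      ENNReal.mul_pos (ENNReal.ofReal_pos.2 (by positivity)).ne'
        (ENNReal.ofReal_pos.2 (by norm_num)).ne'
    refine (hpos.trans_le ?_).ne'
    calc ENNReal.ofReal (1 / 2 * Real.log (4 / 3)) * ENNReal.ofReal (1 / 4)
        = ∫⁻ u in Ioc (1 / 2 : ℝ) (3 / 4), ENNReal.ofReal (1 / 2 * Real.log (4 / 3)) := by
          rw [setLIntegral_const, Real.volume_Ioc]
          norm_num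
      _ ≤ ∫⁻ u in Ioc (1 / 2 : ℝ) (3 / 4), W u := by
          refine setLIntegral_mono' measurableSet_Ioc fun u hu ↦ ENNReal.ofReal_le_ofReal ?_
          have hu0 : 0 < u := lt_trans (by norm_num) hu.1
          have h43 : 4 / 3 ≤ 1 / u := by
            rw [le_div_iff₀ hu0]
            linarith [hu.2]
          gcongr
          exact hu.1.le
      _ ≤ shellMass W 0 := lintegral_mono_set (Ioc_subset_Ioc (by norm_num) (by norm_num))
  have hQpos : ∀ n : ℕ, 0 < 4 * (n + 1) * ((1 / 2 : ℝ) ^ n) ^ 2 := fun n ↦ by positivity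
  -- Q comes from 2r²(1 + 2n log 2) ≤ 4(n+1)r². The shell of index n + 1 has mass at least (n+1)(log
  -- 2) 4⁻⁽ⁿ⁺²⁾, and log 2 > 1/2 gives 128 = 4 · 32.
  refine hB.ae_exists_energy_le hm hd (W := W)
    (Q := fun n ↦ ENNReal.ofReal (4 * (n + 1) * ((1 / 2) ^ n) ^ 2)) (a := ENNReal.ofReal 128)
    (fun u hu ↦ ENNReal.ofReal_le_one.2 ?_) (fun n ↦ ?_) (fun n ↦ ?_)
    (fun n ↦ ENNReal.ofReal_ne_top) (fun n s ↦ ?_) ENNReal.ofReal_ne_top (fun n ↦ ?_) ?_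
  · have h1 := Real.log_le_sub_one_of_pos (one_div_pos.2 hu.1)
    calc u * Real.log (1 / u) ≤ u * (1 / u - 1) := mul_le_mul_of_nonneg_left h1 hu.1.le
      _ = 1 - u := by
          have := hu.1.ne'
          field_simp
      _ ≤ 1 := by linarith [hu.1]
  · rcases n.eq_zero_or_pos with rfl | hn
    · exact hshell0
    · exact ((ENNReal.ofReal_pos.2 (by positivity)).trans_le (hshell n)).ne'
  · exact (ENNReal.ofReal_pos.2 (hQpos n)).ne'
  · refine (lintegral_unitInterval_dist_le (measurable_hitBound 2 _) s).trans ?_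
    calc 2 * ∫⁻ u in Ioc (0 : ℝ) 1, hitBound 2 ((1 / 2) ^ n) u
        ≤ ENNReal.ofReal 2 *
            ENNReal.ofReal (((1 / 2) ^ n) ^ 2 * (1 + 2 * Real.log (1 / (1 / 2) ^ n))) := by
          rw [ENNReal.ofReal_ofNat]
          gcongr
          exact lintegral_hitBound_two_le (by positivity)
            (pow_le_one₀ (by norm_num) (by norm_num))
      _ ≤ _ := by
          rw [← ENNReal.ofReal_mul (by norm_num), hlogpow]
          refine ENNReal.ofReal_le_ofReal ?_
          have h1 : (n : ℝ) * Real.log 2 ≤ n * 1 := by gcongr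
          have h2 : (0 : ℝ) < ((1 / 2) ^ n) ^ 2 := by positivity
          nlinarith
  · refine le_trans ?_ (mul_le_mul' le_rfl (hshell (n + 1)))
    rw [← ENNReal.ofReal_mul (by norm_num)]
    refine ENNReal.ofReal_le_ofReal ?_
    have h2 : (0 : ℝ) < (n + 1) * ((1 / 2) ^ n) ^ 2 := by positivity
    calc 4 * (n + 1) * ((1 / 2 : ℝ) ^ n) ^ 2 = 8 * ((n + 1) * ((1 / 2) ^ n) ^ 2) * (1 / 2) := by
          ring
      _ ≤ 8 * ((n + 1) * ((1 / 2) ^ n) ^ 2) * Real.log 2 := by gcongr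
      _ = _ := by
          push_cast
          ring
  -- The second-moment tail is r⁴ (n+1)^(1/2) · 24576 / (16 (n+1)² r⁴), so all powers of r cancel
  -- and 1536 (n+1)^(-3/2) remains.
  · have hsum : Summable fun n : ℕ ↦
        (1536 : ℝ) * ((n + 1 : ℕ) : ℝ) ^ (-(3 / 2) : ℝ) :=
      ((summable_nat_add_iff 1).2 (Real.summable_nat_rpow.2 (by norm_num))).mul_left _
    refine ne_top_of_le_ne_top hsum.tsum_ofReal_ne_top (ENNReal.tsum_le_tsum fun n ↦ ?_)
    have hn : (0 : ℝ) < n + 1 := by positivity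
    have hg1 : ((n + 1 : ℝ) ^ 2)⁻¹ ≤ 1 := inv_le_one_of_one_le₀ (one_le_pow₀ (by linarith))
    refine (hB.measure_longPairs_two_le hm hd (by positivity)
      (ENNReal.ofReal_pos.2 (hQpos n)).ne' ENNReal.ofReal_ne_top hg1).trans (le_of_eq ?_)
    have h16 : (6 * 16 ^ 3 : ℝ≥0∞) = ENNReal.ofReal 24576 := by
      rw [ENNReal.ofReal_ofNat]
      norm_num
    rw [ENNReal.ofReal_rpow_of_pos (by positivity), h16, ← ENNReal.ofReal_pow (by positivity),
      ← ENNReal.ofReal_pow (by positivity), ← ENNReal.ofReal_pow (by positivity),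
      ← ENNReal.ofReal_mul (by positivity), ← ENNReal.ofReal_mul (by positivity),
      ← ENNReal.ofReal_div_of_pos (by positivity)]
    congr 1
    have h1 : ((((n + 1 : ℝ) ^ 2)⁻¹) ^ (-(1 / 8) : ℝ)) ^ 2 = (n + 1) ^ (1 / 2 : ℝ) := by
      rw [Real.inv_rpow (by positivity), Real.rpow_neg (by positivity), inv_inv,
        ← Real.rpow_natCast _ 2, ← Real.rpow_natCast _ 2, ← Real.rpow_mul hn.le,
        ← Real.rpow_mul hn.le]
      norm_num
    have h2 : (n + 1 : ℝ) ^ (-(3 / 2) : ℝ) = (n + 1) ^ (1 / 2 : ℝ) / (n + 1) ^ 2 := by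
      rw [← Real.rpow_natCast _ 2, ← Real.rpow_sub hn]
      norm_num
    push_cast
    rw [h1, h2]
    field_simp
    ring

end IsBrownianMotion

end

theorem mainTheorem2 {Ω : Type*} [MeasurableSpace Ω] (P : Measure Ω) [IsProbabilityMeasure P]
    (d : ℕ) (B : unitInterval → Ω → EuclideanSpace ℝ (Fin d)) (hB : IsBrownianMotion B P) :
    (3 ≤ d → ∀ᵐ ω ∂P, ∃ C : ℝ≥0, ∀ f : ℝ≥0 → ℝ≥0∞, IsKernelFunction f →
      energy f (occupationMeasure fun t ↦ B t ω) ≤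
        C * ∫⁻ r in Ioc (0 : ℝ) 1, ENNReal.ofReal r * f r.toNNReal) ∧
    (d = 2 → ∀ᵐ ω ∂P, ∃ C : ℝ≥0, ∀ f : ℝ≥0 → ℝ≥0∞, IsKernelFunction f →
      energy f (occupationMeasure fun t ↦ B t ω) ≤
        C * ∫⁻ r in Ioc (0 : ℝ) 1, ENNReal.ofReal (r * Real.log (1 / r)) * f r.toNNReal) := by
  obtain ⟨B', hm, hBB'⟩ := hB.exists_modification
  have hB' : IsBrownianMotion B' P := hB.congr hBB'
  refine ⟨fun hd ↦ ?_, fun hd ↦ ?_⟩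
  · filter_upwards [hBB', hB'.ae_exists_energy_le_of_three_le hm hd] with ω h1 h2
    rwa [show (fun t ↦ B t ω) = fun t ↦ B' t ω from funext fun t ↦ (h1 t).symm]
  · filter_upwards [hBB', hB'.ae_exists_energy_le_of_two_le hm hd.ge] with ω h1 h2
    rwa [show (fun t ↦ B t ω) = fun t ↦ B' t ω from funext fun t ↦ (h1 t).symm]
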